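/- Model. Let $\alpha>2$, $\delta=2/\alpha\in(0,1)$ and $\theta>0$. For each $\lambda>0$ let $\Phi$ be a homogeneous Poisson point process on $\mathbb{R}^2$ of density $\lambda$ (the potential interferers). A receiver is placed at the origin, and its desired, always active transmitter at distance $R$, where $R$ is independent of $\Phi$ and Rayleigh distributed with density $2\pi\mu a\,e^{-\pi\mu a^2}$, $a>0$ (mean $1/(2\sqrt{\mu})$), with $\mu=1$. In a time slot each $z\in\Phi$ is active with probability $p\in(0,1]$ (ALOHA, $B_z\in\{0,1\}$), and the channel gains $h$, $(h_z)_{z\in\Phi}$ are exponential with mean $1$ (Rayleigh fading); given $\Phi$ and $R$, all of $h,h_z,B_z$ are independent. Put $$\mathsf{SIR}=\frac{hR^{-\alpha}}{\sum_{z\in\Phi}B_zh_z\|z\|^{-\alpha}},\qquad P_{\rm s}(\theta)=\mathbb{P}(\mathsf{SIR}>\theta\mid\Phi,R),\qquad \eta(\theta,\epsilon)=\mathbb{P}(P_{\rm s}(\theta)>1-\epsilon).$$ The density of reliable links is $\lambda_\epsilon=\lambda_\epsilon(\lambda,p)=\lambda p\,\eta(\theta,\epsilon)$, and the spatial outage capacity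 is $S(\theta,\epsilon)=\sup_{\lambda>0,\;p\in(0,1]}\lambda_\epsilon(\lambda,p)$. Theorem (SOC in the high-reliability regime, Rayleigh distributed link distances). (i) For all fixed $\lambda>0$ and $p\in(0,1]$, $$\lambda_\epsilon\sim\frac{\epsilon^\delta p^{1-\delta}}{\theta^\delta\,\Gamma(1+\delta)\Gamma(1-\delta)},\qquad \epsilon\to0,$$ where the right-hand side does not depend on $\lambda$. (ii) $S(\theta,\epsilon)$ is finite for every $\epsilon\in(0,1)$, and $$S(\theta,\epsilon)\sim\left(\frac{\epsilon}{\theta}\right)^{\delta}\frac{1}{\Gamma(1+\delta)\Gamma(1-\delta)},\qquad \epsilon\to0.$$ (iii) The SOC is achieved at $p=1$: for all sufficiently small $\epsilon>0$ (depending on $\alpha$ and $\theta$), $S(\theta,\epsilon)=\sup_{\lambda>0}\lambda_\epsilon(\lambda,1)$; and for every fixed $\lambda>0$, $\lambda_\epsilon(\lambda,1)\sim S(\theta,\epsilon)$ as $\epsilon\to0$. -/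

import Mathlib

open Filter Topology MeasureTheory ProbabilityTheory Asymptotics
open scoped ENNReal

noncomputable section

namespace BipolarNetwork

/-- The Euclidean plane. -/
abbrev Plane : Type := EuclideanSpace ℝ (Fin 2)

/-- `Φ` is a (simple, locally finite) Poisson point process on the plane with intensity measure `Λ`:
the numbers of points in Borel sets are random variables, the number of points in a set of finite
intensity is Poisson distributed with parameter the intensity of the set, and the numbers of points
in pairwise disjoint sets are independent. -/
structure IsPoissonProcess {Ω : Type*} [MeasurableSpace Ω] (P : Measure Ω)
    (Φ : Ω → Set Plane) (Λ : Measure Plane) : Prop where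
  locallyFinite : ∀ ω, ∀ K : Set Plane, IsCompact K → (Φ ω ∩ K).Finite
  measurable_count : ∀ B : Set Plane, MeasurableSet B → Measurable fun ω => (Φ ω ∩ B).encard
  law_count : ∀ B : Set Plane, MeasurableSet B → Λ B ≠ ∞ →
    P.map (fun ω => (Φ ω ∩ B).encard)
      = (poissonMeasure (Λ B).toNNReal).map (fun n : ℕ => (n : ℕ∞))
  indep_count : ∀ (n : ℕ) (B : Fin n → Set Plane), (∀ i, MeasurableSet (B i)) →
    Pairwise (fun i j => Disjoint (B i) (B j)) →
      iIndepFun (fun i ω => (Φ ω ∩ B i).encard) P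

/-- Homogeneous Poisson point process on the plane with density `lam`. -/
def IsHomogeneousPoisson {Ω : Type*} [MeasurableSpace Ω] (P : Measure Ω)
    (Φ : Ω → Set Plane) (lam : ℝ) : Prop :=
  IsPoissonProcess P Φ (ENNReal.ofReal lam • volume)

/-- The Rayleigh distribution with mean `1 / (2 * √μ)`, that is, with density
`2 π μ a exp (-π μ a²)` on `a > 0` (the distance from a fixed location to the nearest point of a
planar Poisson process of density `μ`). -/
def rayleighLaw (μ : ℝ) : Measure ℝ :=
  (volume.restrict (Set.Ioi 0)).withDensity fun a =>
    ENNReal.ofReal (2 * Real.pi * μ * a * Real.exp (-(Real.pi * μ * a ^ 2)))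

/-- Channel randomness in one time slot, given the locations `φ` of the potential interferers:
the fading gain of the desired channel, and for each interferer the pair (fading gain, activity).
All gains are exponential with mean `1` (Rayleigh fading), each interferer is active with
probability `p` (ALOHA), and everything is independent. -/
def slotLaw (φ : Set Plane) (p : unitInterval) : Measure (ℝ × (φ → ℝ × Bool)) :=
  (expMeasure 1).prod
    (Measure.infinitePi fun _ : φ => (expMeasure 1).prod (bernoulliMeasure true false p))

/-- Interference at the origin, with path loss exponent `α`: the sum, over the active interferers
`z`, of the gain of `z` times `‖z‖ ^ (-α)`. -/
def interference (α : ℝ) (φ : Set Plane) (m : φ → ℝ × Bool) : ℝ≥0∞ :=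
  ∑' z : φ, if (m z).2 then ENNReal.ofReal (m z).1 * ‖(z : Plane)‖ₑ ^ (-α) else 0

/-- Signal-to-interference ratio at the origin, for a desired transmitter at distance `r`;
`x.1` is the gain of the desired channel. -/
def sir (α : ℝ) (φ : Set Plane) (r : ℝ) (x : ℝ × (φ → ℝ × Bool)) : ℝ≥0∞ :=
  ENNReal.ofReal x.1 * ENNReal.ofReal r ^ (-α) / interference α φ x.2

/-- Conditional link success probability: the probability that the SIR exceeds `θ`,
given the interferer locations `φ` and the link distance `r`, obtained by averaging over
fading and channel access. -/
def condSuccessProb (α θ : ℝ) (p : unitInterval) (φ : Set Plane) (r : ℝ) : ℝ :=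
  (slotLaw φ p).real {x | ENNReal.ofReal θ < sir α φ r x}

/-- Fraction of reliable links (meta distribution of the SIR) for the typical link: the
probability that the conditional link success probability exceeds `1 - ε`, where the receiver is at
the origin, the interferers are the points of `Φ`, and the link distance is Rayleigh distributed
with parameter `μ` and independent of `Φ`. -/
def metaDistribution {Ω : Type*} [MeasurableSpace Ω] (P : Measure Ω) (Φ : Ω → Set Plane)
    (μ α θ : ℝ) (p : unitInterval) (ε : ℝ) : ℝ :=
  (P.prod (rayleighLaw μ)).real {q | 1 - ε < condSuccessProb α θ p (Φ q.1) q.2}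

/-- Density `λ_ε = λ p η(θ, ε)` of reliable links, where `lam` is the density of `Φ`. -/
def reliableDensity {Ω : Type*} [MeasurableSpace Ω] (P : Measure Ω) (Φ : Ω → Set Plane)
    (μ α θ lam : ℝ) (p : unitInterval) (ε : ℝ) : ℝ :=
  lam * p * metaDistribution P Φ μ α θ p ε

/-- The set of densities of reliable links over all `λ > 0` and `p ∈ (0, 1]`;
`Φ lam` is the process of potential transmitters of density `lam`. -/
def reliableDensities {Ω : ℝ → Type*} [∀ lam, MeasurableSpace (Ω lam)]
    (P : ∀ lam, Measure (Ω lam)) (Φ : ∀ lam, Ω lam → Set Plane) (μ α θ ε : ℝ) : Set ℝ :=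
  {x | ∃ lam : ℝ, 0 < lam ∧ ∃ p : unitInterval, 0 < p ∧
    x = reliableDensity (P lam) (Φ lam) μ α θ lam p ε}

/-- Spatial outage capacity `S(θ, ε)`: the supremum of the density of reliable links over `λ > 0`
and `p ∈ (0, 1]`. -/
def spatialOutageCapacity {Ω : ℝ → Type*} [∀ lam, MeasurableSpace (Ω lam)]
    (P : ∀ lam, Measure (Ω lam)) (Φ : ∀ lam, Ω lam → Set Plane) (μ α θ ε : ℝ) : ℝ :=
  sSup (reliableDensities P Φ μ α θ ε)

end BipolarNetwork

end

/-!
Given the interferers and the link distance `R`, Rayleigh fading turns the success probability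
into a product over the interferers (`condSuccessProb_eq`), so a link is reliable when a sum over
the Poisson points, the `totalLoss`, is below `c = -log (1 - ε)`. In a reliable link every single
loss is below `c`, where the loss is almost linear, so the event lies between `{p θ R ^ α Y < c}`
and `{(p - ε) θ R ^ α Y < c}` with the shot noise `Y = ∑ ‖z‖ ^ (-α)`. Since `π R ^ 2` is
exponential, the probabilities of these events are `E[1 - exp (-π (c / k) ^ δ Y ^ (-δ))]`, with
`k = p θ` and `k = (p - ε) θ`. They are asymptotic to, and bounded by, `π (c / k) ^ δ E[Y ^ (-δ)]`,
and `E[Y ^ (-δ)] = 1 / (λ π Γ(1 + δ) Γ(1 - δ))` follows from the Laplace functional of the Poisson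
process (`lintegral_expNeg_tsum`, `lintegral_shotNoise_rpow_neg`). The density `λ` cancels, which
gives the asymptotics for fixed `λ` and `p` (`tendsto_reliableDensity_div_rpow`) together with an
upper bound that is uniform in `λ` (`reliableDensity_le_rpow`).

For the supremum over `p` an exact comparison is used. Scaling by `√p` turns the process of
density `λ` into that of density `λ p`, and multiplies the relative powers by `p ^ (-α / 2)`; for
small `ε` and `p ≥ 2 ε` each admissible loss after scaling dominates the loss of an interferer
that is always active. Hence `λ_ε(λ, p) ≤ λ_ε(λ p, 1)` (`reliableDensity_le_of_rpow_condition`).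
For `p < 2 ε`, and for the finiteness of the capacity, counting the interferers closer than the
desired transmitter is enough (`reliableDensity_le_linear`). For small `ε` the capacity is thus a
supremum over `p = 1` (`eventually_isLUB_spatialOutageCapacity`), and its asymptotics follow from
the bounds at `p = 1`.
-/

namespace BipolarNetwork

/-! ### Laplace functional of a Poisson process -/

/-- The function `x ↦ exp (-x)` on `[0, ∞]`, with `exp (-∞) = 0`. -/
noncomputable def expNeg (x : ℝ≥0∞) : ℝ≥0∞ := EReal.exp (-(x : EReal))

@[simp] lemma expNeg_zero : expNeg 0 = 1 := by simp [expNeg]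

@[simp] lemma expNeg_top : expNeg ∞ = 0 := by simp [expNeg]

lemma expNeg_ofReal {x : ℝ} (hx : 0 ≤ x) :
    expNeg (ENNReal.ofReal x) = ENNReal.ofReal (Real.exp (-x)) := by
  rw [expNeg, EReal.coe_ennreal_ofReal, max_eq_left hx, ← EReal.coe_neg, EReal.exp_coe]

lemma expNeg_add (x y : ℝ≥0∞) : expNeg (x + y) = expNeg x * expNeg y := by
  rw [expNeg, expNeg, expNeg, ← EReal.exp_add, EReal.coe_ennreal_add,
    EReal.neg_add (Or.inl (EReal.coe_ennreal_ne_bot x)) (Or.inr (EReal.coe_ennreal_ne_bot y)),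
    sub_eq_add_neg]

lemma expNeg_sum {ι : Type*} (s : Finset ι) (f : ι → ℝ≥0∞) :
    expNeg (∑ i ∈ s, f i) = ∏ i ∈ s, expNeg (f i) := by
  classical
  induction s using Finset.induction_on with
  | empty => simp
  | insert i s hi ih => rw [Finset.sum_insert hi, Finset.prod_insert hi, expNeg_add, ih]

lemma expNeg_mul_natCast (x : ℝ≥0∞) (n : ℕ) : expNeg (x * n) = expNeg x ^ n := by
  induction n with
  | zero => simp
  | succ n ih => rw [Nat.cast_succ, mul_add, mul_one, expNeg_add, ih, pow_succ]

lemma continuous_expNeg : Continuous expNeg :=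
  ENNReal.continuous_exp.comp (continuous_neg.comp continuous_coe_ennreal_ereal)

lemma strictAnti_expNeg : StrictAnti expNeg := fun _ _ h =>
  EReal.exp_strictMono (EReal.neg_lt_neg_iff.2 (EReal.coe_ennreal_lt_coe_ennreal_iff.2 h))

@[fun_prop]
lemma measurable_expNeg : Measurable expNeg := continuous_expNeg.measurable

lemma expNeg_le_one (x : ℝ≥0∞) : expNeg x ≤ 1 := by
  rw [← expNeg_zero]; exact strictAnti_expNeg.antitone zero_le

lemma expNeg_ne_top (x : ℝ≥0∞) : expNeg x ≠ ∞ :=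
  ne_top_of_le_ne_top ENNReal.one_ne_top (expNeg_le_one x)

lemma expNeg_iSup_nat {f : ℕ → ℝ≥0∞} (hf : Monotone f) :
    Tendsto (fun n => expNeg (f n)) atTop (𝓝 (expNeg (⨆ n, f n))) :=
  (continuous_expNeg.tendsto _).comp (tendsto_atTop_iSup hf)

/-- The counting measure of a set of points in the plane, written as a sum of Dirac masses, so that
integrals against it are sums over the points. -/
noncomputable def countOn (φ : Set Plane) : Measure Plane :=
  Measure.sum fun z : φ => Measure.dirac (z : Plane)

lemma lintegral_countOn (φ : Set Plane) (f : Plane → ℝ≥0∞) :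
    ∫⁻ z, f z ∂countOn φ = ∑' z : φ, f z := by
  simp [countOn, lintegral_sum_measure]

lemma countOn_apply (φ : Set Plane) {B : Set Plane} (hB : MeasurableSet B) :
    countOn φ B = ((φ ∩ B).encard : ℝ≥0∞) := by
  rw [← lintegral_indicator_one hB, lintegral_countOn, ← ENNReal.tsum_set_one, tsum_subtype φ,
    tsum_subtype (φ ∩ B) (fun _ => 1)]
  congr 1; ext z
  by_cases h1 : z ∈ φ <;> by_cases h2 : z ∈ B <;> simp [h1, h2]

section PoissonPoints

variable {Ω : Type*} [MeasurableSpace Ω] {P : Measure Ω} {Φ : Ω → Set Plane} {Λ : Measure Plane}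

/-- A Poisson process as a random counting measure, that is, a kernel from the probability space to
the plane. -/
noncomputable def countKernel (hΦ : IsPoissonProcess P Φ Λ) : Kernel Ω Plane where
  toFun ω := countOn (Φ ω)
  measurable' := by
    refine Measure.measurable_of_measurable_coe _ fun B hB => ?_
    simp_rw [countOn_apply _ hB]
    exact (measurable_of_countable (fun n : ℕ∞ => (n : ℝ≥0∞))).comp (hΦ.measurable_count B hB)

/-- A kernel of finite measures is s-finite, even if the masses are unbounded: cut according
to the integer part of the mass. -/
lemma isSFiniteKernel_of_isFiniteMeasure {α β : Type*} [MeasurableSpace α] [MeasurableSpace β]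
    (κ : Kernel α β) (h : ∀ a, IsFiniteMeasure (κ a)) : IsSFiniteKernel κ := by
  classical
  let M : α → ℕ := fun a => ⌊(κ a Set.univ).toReal⌋₊
  have hM : Measurable M :=
    Nat.measurable_floor.comp (κ.measurable_coe MeasurableSet.univ).ennreal_toReal
  have hs : ∀ m, MeasurableSet {a | M a = m} := fun m => hM (measurableSet_singleton m)
  let K : ℕ → Kernel α β := fun m => Kernel.piecewise (hs m) κ 0
  have hK : κ = Kernel.sum K := by
    ext a B hB
    rw [Kernel.sum_apply' _ _ hB, tsum_eq_single (M a)]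
    · simp [K, Kernel.piecewise_apply]
    · intro m hm
      simp [K, Kernel.piecewise_apply, hm.symm]
  have : ∀ m, IsFiniteKernel (K m) := fun m => by
    refine ⟨⟨m + 1, by finiteness, fun a => ?_⟩⟩
    by_cases ha : M a = m
    · have h1 : K m a = κ a := by simp [K, Kernel.piecewise_apply, ha]
      rw [h1, ← ENNReal.ofReal_toReal (measure_ne_top (κ a) Set.univ)]
      have := (Nat.lt_floor_add_one (κ a Set.univ).toReal).le
      rw [show ⌊(κ a Set.univ).toReal⌋₊ = m from ha] at this
      refine (ENNReal.ofReal_le_ofReal this).trans ?_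
      rw [ENNReal.ofReal_add (by positivity) (by positivity)]
      simp
    · simp [K, Kernel.piecewise_apply, ha]
  rw [hK]
  infer_instance

/-- The counting kernel is s-finite: each annulus `k ≤ ‖x‖ < k + 1` has finitely many points. -/
lemma isSFiniteKernel_countKernel (hΦ : IsPoissonProcess P Φ Λ) :
    IsSFiniteKernel (countKernel hΦ) := by
  let A : ℕ → Set Plane := fun k => {x | ⌊‖x‖⌋₊ = k}
  have hA : ∀ k, MeasurableSet (A k) := fun k =>
    (Nat.measurable_floor.comp measurable_norm) (measurableSet_singleton k)
  have hK : countKernel hΦ = Kernel.sum fun k => (countKernel hΦ).restrict (hA k) := by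
    ext1 ω
    rw [Kernel.sum_apply]
    simp_rw [Kernel.restrict_apply]
    rw [← Measure.restrict_iUnion _ hA]
    · have : ⋃ k, A k = Set.univ := by ext x; simp [A]
      rw [this, Measure.restrict_univ]
    · intro i j hij
      refine Set.disjoint_left.2 fun x hx hx' => hij ?_
      exact hx.symm.trans hx'
  have : ∀ k, IsSFiniteKernel ((countKernel hΦ).restrict (hA k)) := fun k => by
    refine isSFiniteKernel_of_isFiniteMeasure _ fun ω => ⟨?_⟩
    rw [Kernel.restrict_apply, Measure.restrict_apply_univ]
    change countOn (Φ ω) (A k) < ∞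
    rw [countOn_apply _ (hA k)]
    have h1 : (Φ ω ∩ A k).Finite := by
      refine (hΦ.locallyFinite ω (Metric.closedBall 0 (k + 1)) (isCompact_closedBall _ _)).subset ?_
      refine Set.inter_subset_inter_right _ fun x hx => ?_
      have := (Nat.lt_floor_add_one ‖x‖).le
      rw [show ⌊‖x‖⌋₊ = k from hx] at this
      simpa using this
    simpa [Set.encard_lt_top_iff] using h1
  rw [hK]
  infer_instance

/-- Joint measurability of sums over the points whose summand depends on a parameter; Fubini over
the process and the link distance rests on it. -/
lemma measurable_tsum_prod (hΦ : IsPoissonProcess P Φ Λ) {T : Type*} [MeasurableSpace T]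
    {f : T → Plane → ℝ≥0∞} (hf : Measurable (Function.uncurry f)) :
    Measurable fun q : Ω × T => ∑' z : Φ q.1, f q.2 z := by
  have := isSFiniteKernel_countKernel hΦ
  have h := Measurable.lintegral_kernel_prod_right
    (κ := (countKernel hΦ).comap (Prod.fst : Ω × T → Ω) measurable_fst)
    (f := fun q z => f q.2 z)
    (hf.comp (by fun_prop : Measurable fun x : (Ω × T) × Plane => (x.1.2, x.2)))
  simp_rw [Kernel.comap_apply] at h
  simpa only [countKernel, Kernel.coe_mk, lintegral_countOn] using h

lemma measurable_tsum (hΦ : IsPoissonProcess P Φ Λ) {f : Plane → ℝ≥0∞} (hf : Measurable f) :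
    Measurable fun ω => ∑' z : Φ ω, f z :=
  (measurable_tsum_prod hΦ (T := Unit) (f := fun _ => f) (hf.comp measurable_snd)).comp
    (measurable_id.prodMk (measurable_const (a := ())))

lemma lintegral_expNeg_poisson (m : NNReal) (a : ℝ≥0∞) :
    ∫⁻ n : ℕ, expNeg (a * n) ∂poissonMeasure m = expNeg (m * (1 - expNeg a)) := by
  obtain ⟨q, hq0, hq1, hq⟩ : ∃ q : ℝ, 0 ≤ q ∧ q ≤ 1 ∧ expNeg a = ENNReal.ofReal q :=
    ⟨(expNeg a).toReal, ENNReal.toReal_nonneg,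
      ENNReal.toReal_le_of_le_ofReal zero_le_one (by simpa using expNeg_le_one a),
      (ENNReal.ofReal_toReal (expNeg_ne_top a)).symm⟩
  have h1 : ∀ n : ℕ, expNeg (a * n) * poissonMeasure m {n}
      = ENNReal.ofReal (Real.exp (-m) * ((m * q) ^ n / n.factorial)) := fun n => by
    rw [expNeg_mul_natCast, hq, poissonMeasure_singleton, ← ENNReal.ofReal_pow hq0,
      ← ENNReal.ofReal_mul (by positivity)]
    congr 1; rw [mul_pow]; ring
  rw [lintegral_countable']
  simp_rw [h1]
  have hs : HasSum (fun n : ℕ => Real.exp (-m) * ((m * q) ^ n / n.factorial))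
      (Real.exp (-m) * Real.exp (m * q)) := by
    have := NormedSpace.expSeries_div_hasSum_exp (𝔸 := ℝ) ((m : ℝ) * q)
    rw [← Real.exp_eq_exp_ℝ] at this
    exact this.mul_left _
  rw [← ENNReal.ofReal_tsum_of_nonneg (fun n => by positivity) hs.summable, hs.tsum_eq, hq,
    ← Real.exp_add, ← ENNReal.ofReal_one, ← ENNReal.ofReal_sub _ hq0, ← ENNReal.ofReal_coe_nnreal,
    ← ENNReal.ofReal_mul (by positivity), expNeg_ofReal (mul_nonneg (by positivity) (by linarith))]
  congr 2; ring

lemma lintegral_expNeg_count (hΦ : IsPoissonProcess P Φ Λ) {B : Set Plane} (hB : MeasurableSet B)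
    (hΛ : Λ B ≠ ∞) (a : ℝ≥0∞) :
    ∫⁻ ω, expNeg (a * (Φ ω ∩ B).encard) ∂P = expNeg (Λ B * (1 - expNeg a)) := by
  have hm : Measurable fun n : ℕ∞ => expNeg (a * n) := measurable_of_countable _
  rw [← lintegral_map hm (hΦ.measurable_count B hB), hΦ.law_count B hB hΛ,
    lintegral_map hm (measurable_of_countable _)]
  simp only [ENat.toENNReal_coe]
  rw [lintegral_expNeg_poisson, ENNReal.coe_toNNReal hΛ]

/-- The Laplace functional on simple functions: the sum over the points is a combination of the
independent Poisson counts of the level sets. Only the level set of `0` may have infinite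
intensity. -/
lemma lintegral_expNeg_simpleFunc (hΦ : IsPoissonProcess P Φ Λ) (f : SimpleFunc Plane ℝ≥0∞)
    (hf : ∀ y ≠ 0, Λ (f ⁻¹' {y}) ≠ ∞) :
    ∫⁻ ω, expNeg (∑' z : Φ ω, f z) ∂P = expNeg (∫⁻ z, (1 - expNeg (f z)) ∂Λ) := by
  have h1 : ∀ ω, expNeg (∑' z : Φ ω, f z)
      = ∏ i : Fin f.range.card, expNeg ((f.range.equivFin.symm i : ℝ≥0∞) *
          (Φ ω ∩ f ⁻¹' {(f.range.equivFin.symm i : ℝ≥0∞)}).encard) := fun ω => by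
    rw [← lintegral_countOn, SimpleFunc.lintegral_eq_lintegral, SimpleFunc.lintegral, expNeg_sum,
      ← Finset.prod_coe_sort, ← f.range.equivFin.symm.prod_comp]
    simp_rw [countOn_apply _ (f.measurableSet_preimage _)]
  have hind := hΦ.indep_count f.range.card
    (fun i => f ⁻¹' {(f.range.equivFin.symm i : ℝ≥0∞)}) (fun i => f.measurableSet_preimage _)
    (fun i j hij => by
      refine Set.disjoint_left.2 fun x hx hx' => hij ?_
      exact f.range.equivFin.symm.injective (Subtype.ext (hx.symm.trans hx')))
  simp_rw [h1]
  have hprod := lintegral_prod_eq_prod_lintegral_of_indepFun Finset.univ _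
    (hind.comp (fun i (n : ℕ∞) => expNeg ((f.range.equivFin.symm i : ℝ≥0∞) * n))
      (fun i => measurable_of_countable _))
    (fun i => (measurable_of_countable _).comp
      (hΦ.measurable_count _ (f.measurableSet_preimage _)))
  simp only [Function.comp_def] at hprod
  rw [hprod]
  have h2 : ∀ i : Fin f.range.card, ∫⁻ ω, expNeg ((f.range.equivFin.symm i : ℝ≥0∞) *
        (Φ ω ∩ f ⁻¹' {(f.range.equivFin.symm i : ℝ≥0∞)}).encard) ∂P
      = expNeg ((1 - expNeg (f.range.equivFin.symm i : ℝ≥0∞)) *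
          Λ (f ⁻¹' {(f.range.equivFin.symm i : ℝ≥0∞)})) := fun i => by
    rcases eq_or_ne (f.range.equivFin.symm i : ℝ≥0∞) 0 with h0 | h0
    · have := hind.isProbabilityMeasure
      simp [h0]
    · rw [lintegral_expNeg_count hΦ (f.measurableSet_preimage _) (hf _ h0), mul_comm]
  simp_rw [h2]
  have h3 : ∫⁻ z, (1 - expNeg (f z)) ∂Λ = (f.map fun y => 1 - expNeg y).lintegral Λ := by
    rw [← SimpleFunc.lintegral_eq_lintegral]; rfl
  rw [h3, SimpleFunc.map_lintegral, expNeg_sum, ← Finset.prod_coe_sort f.range,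
    ← f.range.equivFin.symm.prod_comp]

/-- The Laplace functional of a Poisson process with intensity measure `Λ`:
`E exp (-∑ f) = exp (-∫ (1 - exp (-f)) dΛ)`. -/
theorem lintegral_expNeg_tsum [IsFiniteMeasureOnCompacts Λ] [IsFiniteMeasure P]
    (hΦ : IsPoissonProcess P Φ Λ)
    {f : Plane → ℝ≥0∞} (hf : Measurable f) :
    ∫⁻ ω, expNeg (∑' z : Φ ω, f z) ∂P = expNeg (∫⁻ z, (1 - expNeg (f z)) ∂Λ) := by
  -- simple functions of bounded support increasing to `f`
  let g : ℕ → SimpleFunc Plane ℝ≥0∞ := fun n =>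
    (SimpleFunc.eapprox f n).restrict (Metric.closedBall 0 n)
  have hg : ∀ n z, g n z = (Metric.closedBall (0 : Plane) n).indicator (SimpleFunc.eapprox f n) z :=
    fun n z => by
      simp only [g]; rw [SimpleFunc.restrict_apply _ Metric.isClosed_closedBall.measurableSet]
  have hmono : ∀ z, Monotone fun n => g n z := fun z m n hmn => by
    simp only [hg]
    refine (Set.indicator_le_indicator (SimpleFunc.monotone_eapprox f hmn z)).trans ?_
    refine Set.indicator_le_indicator_of_subset ?_ (fun _ => zero_le) z
    exact Metric.closedBall_subset_closedBall (by exact_mod_cast hmn)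
  have hsup : ∀ z, ⨆ n, g n z = f z := fun z => by
    rw [← SimpleFunc.iSup_eapprox_apply hf z]
    refine le_antisymm (iSup_mono fun n => ?_) (iSup_le fun n => ?_)
    · rw [hg]; exact Set.indicator_le_self _ _ z
    · obtain ⟨m, hm⟩ := exists_nat_ge ‖z‖
      refine le_iSup_of_le (max n m) ?_
      rw [hg, Set.indicator_of_mem]
      · exact SimpleFunc.monotone_eapprox f (le_max_left n m) z
      · have : (m : ℝ) ≤ (max n m : ℕ) := by exact_mod_cast le_max_right n m
        simpa using hm.trans this
  have hfin : ∀ n, ∀ y ≠ 0, Λ (g n ⁻¹' {y}) ≠ ∞ := fun n y hy => by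
    refine ne_top_of_le_ne_top (isCompact_closedBall (0 : Plane) n).measure_lt_top.ne
      (measure_mono fun z hz => ?_)
    by_contra hcon
    have : g n z = y := hz
    rw [hg, Set.indicator_of_notMem hcon] at this
    exact hy this.symm
  have hkey := fun n => lintegral_expNeg_simpleFunc hΦ (g n) (hfin n)
  have hL : Tendsto (fun n => ∫⁻ ω, expNeg (∑' z : Φ ω, g n z) ∂P) atTop
      (𝓝 (∫⁻ ω, expNeg (∑' z : Φ ω, f z) ∂P)) := by
    refine tendsto_lintegral_of_dominated_convergence 1
      (fun n => measurable_expNeg.comp (measurable_tsum hΦ (g n).measurable))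
      (fun n => ae_of_all _ fun ω => expNeg_le_one _) (by simp)
      (ae_of_all _ fun ω => ?_)
    simp_rw [← lintegral_countOn]
    have : ∫⁻ z, f z ∂countOn (Φ ω) = ⨆ n, ∫⁻ z, g n z ∂countOn (Φ ω) := by
      simp_rw [← hsup]
      exact lintegral_iSup (fun n => (g n).measurable) (fun m n hmn z => hmono z hmn)
    rw [this]
    exact expNeg_iSup_nat fun m n hmn => lintegral_mono fun z => hmono z hmn
  have hR : Tendsto (fun n => ∫⁻ z, (1 - expNeg (g n z)) ∂Λ) atTop
      (𝓝 (∫⁻ z, (1 - expNeg (f z)) ∂Λ)) := by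
    refine lintegral_tendsto_of_tendsto_of_monotone
      (fun n => (measurable_const.sub (measurable_expNeg.comp (g n).measurable)).aemeasurable)
      (ae_of_all _ fun z m n hmn => tsub_le_tsub_left (strictAnti_expNeg.antitone (hmono z hmn)) _)
      (ae_of_all _ fun z => ?_)
    rw [← hsup z]
    exact ENNReal.Tendsto.sub tendsto_const_nhds (expNeg_iSup_nat (hmono z)) (Or.inl (by simp))
  refine tendsto_nhds_unique hL ?_
  simp_rw [hkey]
  exact (continuous_expNeg.tendsto _).comp hR

end PoissonPoints

/-! ### Conditional success probability -/

/-- For independent marks, the Laplace transform of a countable sum is the product of the Laplace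
transforms, here written with exponents `G i`. -/
lemma lintegral_infinitePi_expNeg_tsum {ι : Type*} [Countable ι] {X : ι → Type*}
    [∀ i, MeasurableSpace (X i)] (μ : ∀ i, Measure (X i)) [∀ i, IsProbabilityMeasure (μ i)]
    {g : ∀ i, X i → ℝ≥0∞} (hg : ∀ i, Measurable (g i)) {G : ι → ℝ≥0∞}
    (hG : ∀ i, ∫⁻ x, expNeg (g i x) ∂μ i = expNeg (G i)) :
    ∫⁻ m, expNeg (∑' i, g i (m i)) ∂Measure.infinitePi μ = expNeg (∑' i, G i) := by
  have hfin : ∀ s : Finset ι, ∫⁻ m, expNeg (∑ i ∈ s, g i (m i)) ∂Measure.infinitePi μ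
      = expNeg (∑ i ∈ s, G i) := fun s => by
    have hme : ∀ i, Measurable fun x : X i => expNeg (g i x) :=
      fun i => measurable_expNeg.comp (hg i)
    simp_rw [expNeg_sum]
    rw [lintegral_prod_eq_prod_lintegral_of_indepFun s (fun i (m : ∀ i, X i) => expNeg (g i (m i)))
      (iIndepFun_infinitePi (P := μ) (X := fun i x => expNeg (g i x)) hme)
      (fun i => (hme i).comp (measurable_pi_apply i))]
    refine Finset.prod_congr rfl fun i _ => ?_
    rw [← hG i, ← Measure.infinitePi_map_eval μ i, lintegral_map (hme i) (measurable_pi_apply i)]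
  have hL : Tendsto (fun s : Finset ι => ∫⁻ m, expNeg (∑ i ∈ s, g i (m i)) ∂Measure.infinitePi μ)
      atTop (𝓝 (∫⁻ m, expNeg (∑' i, g i (m i)) ∂Measure.infinitePi μ)) := by
    refine tendsto_lintegral_filter_of_dominated_convergence 1
      (Eventually.of_forall fun s => measurable_expNeg.comp
        (Finset.measurable_sum s fun i _ => (hg i).comp (measurable_pi_apply i)))
      (Eventually.of_forall fun s => ae_of_all _ fun ω => expNeg_le_one _) (by simp)
      (ae_of_all _ fun ω => ?_)
    exact (continuous_expNeg.tendsto _).comp ENNReal.summable.hasSum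
  refine tendsto_nhds_unique hL ?_
  simp_rw [hfin]
  exact (continuous_expNeg.tendsto _).comp ENNReal.summable.hasSum

instance isProbabilityMeasure_expMeasure_one : IsProbabilityMeasure (expMeasure 1) :=
  isProbabilityMeasure_expMeasure one_pos

instance isProbabilityMeasure_bernoulliMeasure_bool (p : unitInterval) :
    IsProbabilityMeasure (bernoulliMeasure true false p) := ⟨by simp⟩

lemma expMeasure_one_lt_ofReal (x : ℝ≥0∞) :
    expMeasure 1 {h | x < ENNReal.ofReal h} = expNeg x := by
  rcases eq_or_ne x ∞ with rfl | hx
  · simp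
  have h1 : {h : ℝ | x < ENNReal.ofReal h} = (Set.Iic x.toReal)ᶜ := by
    ext h; simp [ENNReal.lt_ofReal_iff_toReal_lt hx]
  rw [h1, prob_compl_eq_one_sub measurableSet_Iic, ← ofReal_cdf, cdf_expMeasure_eq one_pos,
    if_pos ENNReal.toReal_nonneg, one_mul]
  conv_rhs => rw [← ENNReal.ofReal_toReal hx, expNeg_ofReal ENNReal.toReal_nonneg]
  rw [← ENNReal.ofReal_one, ← ENNReal.ofReal_sub _
    (by simp)]
  congr 1; ring

/-- The Laplace transform of the exponential distribution. Multiplying the density of rate `1` by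
`exp (-a h)` gives the density of rate `1 + a`, up to the factor `1 / (1 + a)`. -/
lemma lintegral_expNeg_expMeasure {a : ℝ} (ha : 0 ≤ a) :
    ∫⁻ h, expNeg (ENNReal.ofReal h * ENNReal.ofReal a) ∂expMeasure 1
      = ENNReal.ofReal (1 / (1 + a)) := by
  have h1 : ∀ h : ℝ, exponentialPDF 1 h * expNeg (ENNReal.ofReal h * ENNReal.ofReal a)
      = ENNReal.ofReal (1 / (1 + a)) * exponentialPDF (1 + a) h := fun h => by
    rcases lt_or_ge h 0 with hh | hh
    · simp [exponentialPDF_of_neg hh]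
    · rw [exponentialPDF_of_nonneg hh, exponentialPDF_of_nonneg hh, ← ENNReal.ofReal_mul hh,
        expNeg_ofReal (mul_nonneg hh ha), ← ENNReal.ofReal_mul (by positivity),
        ← ENNReal.ofReal_mul (by positivity), one_mul, ← Real.exp_add]
      congr 1
      field_simp
      congr 1; ring
  have h2 : expMeasure 1 = volume.withDensity (exponentialPDF 1) := rfl
  have h3 : Measurable (exponentialPDF 1) := (measurable_exponentialPDFReal 1).ennreal_ofReal
  have h4 : Measurable (exponentialPDF (1 + a)) :=
    (measurable_exponentialPDFReal (1 + a)).ennreal_ofReal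
  rw [h2, lintegral_withDensity_eq_lintegral_mul _ h3 (by fun_prop)]
  simp only [Pi.mul_apply, h1]
  rw [lintegral_const_mul _ h4, lintegral_exponentialPDF_eq_one (by linarith), mul_one]

/-- Contribution of one interferer to minus the logarithm of the conditional success probability,
where `x` is `θ` times the ratio of its mean received power to that of the desired signal: under
Rayleigh fading and access probability `p`, the interferer multiplies the success probability by
`1 - p * x / (1 + x)`. -/
noncomputable def logLoss (p x : ℝ) : ℝ := -Real.log (1 - p * (x / (1 + x)))

lemma one_sub_mul_div_pos {p x : ℝ} (hp1 : p ≤ 1) (hx : 0 ≤ x) :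
    0 < 1 - p * (x / (1 + x)) := by
  have h1 : x / (1 + x) < 1 := by rw [div_lt_one (by linarith)]; linarith
  have h2 : 0 ≤ x / (1 + x) := by positivity
  nlinarith

lemma logLoss_nonneg {p x : ℝ} (hp0 : 0 ≤ p) (hp1 : p ≤ 1) (hx : 0 ≤ x) : 0 ≤ logLoss p x := by
  have h2 : 0 ≤ p * (x / (1 + x)) := by positivity
  exact neg_nonneg.2 (Real.log_nonpos (one_sub_mul_div_pos hp1 hx).le (by linarith))

lemma expNeg_logLoss {p x : ℝ} (hp0 : 0 ≤ p) (hp1 : p ≤ 1) (hx : 0 ≤ x) :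
    expNeg (ENNReal.ofReal (logLoss p x)) = ENNReal.ofReal (1 - p * (x / (1 + x))) := by
  rw [expNeg_ofReal (logLoss_nonneg hp0 hp1 hx), logLoss, neg_neg,
    Real.exp_log (one_sub_mul_div_pos hp1 hx)]

lemma measurable_logLoss (p : ℝ) : Measurable (logLoss p) := by
  unfold logLoss; fun_prop

lemma measurable_mark (a : ℝ≥0∞) :
    Measurable fun m : ℝ × Bool => if m.2 then ENNReal.ofReal m.1 * a else 0 :=
  Measurable.ite (measurable_snd (measurableSet_singleton true)) (by fun_prop) measurable_const

lemma lintegral_expNeg_mark (p : unitInterval) {a : ℝ} (ha : 0 ≤ a) :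
    ∫⁻ m, expNeg (if m.2 then ENNReal.ofReal m.1 * ENNReal.ofReal a else 0)
        ∂(expMeasure 1).prod (bernoulliMeasure true false p)
      = expNeg (ENNReal.ofReal (logLoss p a)) := by
  have hm : Measurable fun m : ℝ × Bool =>
      expNeg (if m.2 then ENNReal.ofReal m.1 * ENNReal.ofReal a else 0) :=
    measurable_expNeg.comp (measurable_mark _)
  rw [lintegral_prod_symm' _ hm, bernoulliMeasure_def,
    lintegral_add_measure, lintegral_smul_measure, lintegral_smul_measure, lintegral_dirac,
    lintegral_dirac]
  simp only [if_true, lintegral_expNeg_expMeasure ha, Bool.false_eq_true, if_false, expNeg_zero,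
    lintegral_const, measure_univ, mul_one]
  rw [expNeg_logLoss p.2.1 p.2.2 ha]
  have e1 : (unitInterval.toNNReal p : ℝ≥0∞) = ENNReal.ofReal p := by
    rw [← ENNReal.ofReal_coe_nnreal]; rfl
  have e2 : (unitInterval.toNNReal (unitInterval.symm p) : ℝ≥0∞) = ENNReal.ofReal (1 - p) := by
    rw [← ENNReal.ofReal_coe_nnreal]; rfl
  have hp1 : 0 ≤ 1 - (p : ℝ) := by linarith [p.2.2]
  rw [ENNReal.smul_def, ENNReal.smul_def, e1, e2, smul_eq_mul, smul_eq_mul, mul_one,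
    ← ENNReal.ofReal_mul p.2.1, ← ENNReal.ofReal_add (mul_nonneg p.2.1 (by positivity)) hp1]
  congr 1
  field_simp
  ring

/-- `θ` times the ratio of the mean power received from an active interferer at `z` to the mean
power received from the desired transmitter at distance `r`. At `z = 0` the value is the junk value
`0`; almost surely no interferer sits there. -/
noncomputable def gain (α θ r : ℝ) (z : Plane) : ℝ := θ * r ^ α * ‖z‖ ^ (-α)

lemma gain_nonneg {α θ r : ℝ} (hθ : 0 < θ) (hr : 0 < r) (z : Plane) : 0 ≤ gain α θ r z := by
  unfold gain; positivity

lemma measurable_gain (α θ : ℝ) : Measurable (Function.uncurry (gain α θ)) := by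
  unfold gain Function.uncurry; fun_prop

/-- Averaging over the desired fading gain gives `P(SIR > θ) = E exp (-θ r ^ α I)`, which is a
product over the interferers. -/
theorem condSuccessProb_eq {α θ r : ℝ} (hθ : 0 < θ) (hr : 0 < r) (p : unitInterval)
    {φ : Set Plane} (hφ : φ.Countable) (h0 : 0 ∉ φ) :
    condSuccessProb α θ p φ r
      = (expNeg (∑' z : φ, ENNReal.ofReal (logLoss p (gain α θ r z)))).toReal := by
  have := hφ.to_subtype
  have hI : Measurable (interference α φ) :=
    Measurable.tsum fun z => (measurable_mark _).comp (measurable_pi_apply z)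
  have hS : MeasurableSet {x : ℝ × (φ → ℝ × Bool) | ENNReal.ofReal θ < sir α φ r x} := by
    refine measurableSet_lt measurable_const ?_
    unfold sir
    exact ((measurable_fst.ennreal_ofReal).mul_const _).div (hI.comp measurable_snd)
  have hr0 : ENNReal.ofReal r ^ (-α) = ENNReal.ofReal (r ^ (-α)) :=
    ENNReal.ofReal_rpow_of_pos hr
  have hsec : ∀ m : φ → ℝ × Bool,
      expMeasure 1 ((fun h => (h, m)) ⁻¹' {x | ENNReal.ofReal θ < sir α φ r x})
        = expNeg (ENNReal.ofReal (θ * r ^ α) * interference α φ m) := fun m => by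
    rw [← expMeasure_one_lt_ofReal]
    congr 1
    ext h
    have hpos : 0 < r ^ α := Real.rpow_pos_of_pos hr α
    have e1 : ENNReal.ofReal (r ^ (-α)) * ENNReal.ofReal (r ^ α) = 1 := by
      rw [← ENNReal.ofReal_mul (by positivity), ← Real.rpow_add hr]; simp
    simp only [Set.mem_preimage, Set.mem_ofPred_eq, sir, hr0]
    rw [ENNReal.lt_div_iff_mul_lt (Or.inr ENNReal.ofReal_ne_top)
      (Or.inr (ENNReal.ofReal_pos.2 hθ).ne'),
      ← ENNReal.mul_lt_mul_iff_left (ENNReal.ofReal_pos.2 hpos).ne' ENNReal.ofReal_ne_top,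
      mul_assoc (ENNReal.ofReal h), e1, mul_one, ENNReal.ofReal_mul hθ.le, mul_right_comm]
  have hterm : ∀ m : φ → ℝ × Bool, ENNReal.ofReal (θ * r ^ α) * interference α φ m
      = ∑' z : φ, if (m z).2 then ENNReal.ofReal (m z).1 * ENNReal.ofReal (gain α θ r z) else 0 :=
    fun m => by
      rw [interference, ← ENNReal.tsum_mul_left]
      refine tsum_congr fun z => ?_
      have hz : 0 < ‖(z : Plane)‖ := norm_pos_iff.2 fun h => h0 (h ▸ z.2)
      split_ifs
      · rw [← ofReal_norm, ENNReal.ofReal_rpow_of_pos hz, gain,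
          ENNReal.ofReal_mul (p := θ * r ^ α) (by positivity)]
        ring
      · simp
  rw [condSuccessProb, measureReal_def, slotLaw, Measure.prod_apply_symm hS]
  simp_rw [hsec, hterm]
  rw [lintegral_infinitePi_expNeg_tsum (fun _ : φ => (expMeasure 1).prod
      (bernoulliMeasure true false p)) (fun z => measurable_mark _)
      (fun z => lintegral_expNeg_mark p (gain_nonneg hθ hr _))]

/-! ### Shot noise and its negative moment; the Rayleigh law -/

lemma lintegral_ofReal_eq_of_integral_eq {β : Type*} [MeasurableSpace β] {μ : Measure β}
    {f : β → ℝ} {c : ℝ}     (hf : 0 ≤ᵐ[μ] f) (hc : c ≠ 0) (h : ∫ x, f x ∂μ = c) :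
    ∫⁻ x, ENNReal.ofReal (f x) ∂μ = ENNReal.ofReal c := by
  rw [← h, ofReal_integral_eq_lintegral_ofReal (Integrable.of_integral_ne_zero (h ▸ hc)) hf]

lemma lintegral_rpow_mul_exp_neg {a r : ℝ} (ha : 0 < a) (hr : 0 < r) :
    ∫⁻ t in Set.Ioi (0 : ℝ), ENNReal.ofReal (t ^ (a - 1) * Real.exp (-(r * t)))
      = ENNReal.ofReal ((1 / r) ^ a * Real.Gamma a) := by
  refine lintegral_ofReal_eq_of_integral_eq ?_ ?_ (Real.integral_rpow_mul_exp_neg_mul_Ioi ha hr)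
  · filter_upwards [ae_restrict_mem measurableSet_Ioi] with t ht
    have : 0 < t := ht
    positivity
  · have := Real.Gamma_pos_of_pos ha
    positivity

lemma volume_lt_norm_rpow {α t : ℝ} (hα : 0 < α) (ht : 0 < t) :
    volume {z : Plane | t < ‖z‖ ^ (-α)} = ENNReal.ofReal (Real.pi * t ^ (-(2 / α))) := by
  have h1 : {z : Plane | t < ‖z‖ ^ (-α)} = Metric.ball 0 (t ^ (-(1 / α))) \ {0} := by
    ext z
    rcases eq_or_ne z 0 with rfl | hz
    · simp [Real.zero_rpow (neg_ne_zero.2 hα.ne'), ht.le]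
    · have hz' : 0 < ‖z‖ := norm_pos_iff.2 hz
      have : ‖z‖ < t ^ (-(1 / α)) ↔ t < ‖z‖ ^ (-α) := by
        rw [show -(1 / α) = (-α)⁻¹ by rw [inv_neg, one_div]]
        exact Real.lt_rpow_inv_iff_of_neg hz' ht (by linarith)
      simpa [hz] using this.symm
  rw [h1, measure_sdiff_null (measure_singleton 0), EuclideanSpace.volume_ball_fin_two,
    ← ENNReal.ofReal_pow (by positivity), ← ENNReal.ofReal_mul (by positivity),
    ← Real.rpow_natCast, ← Real.rpow_mul ht.le, mul_comm]
  congr 3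
  push_cast; ring

/-- The Laplace exponent of the shot noise. By the layer-cake formula it is the Gamma integral of
`s * exp (-s t) * π * t ^ (-2 / α)`, as `‖z‖ ^ (-α) > t` describes a disc of area
`π * t ^ (-2 / α)` without its centre. -/
lemma lintegral_one_sub_expNeg_norm_rpow {α s : ℝ} (hα : 2 < α) (hs : 0 < s) :
    ∫⁻ z : Plane, (1 - expNeg (ENNReal.ofReal (s * ‖z‖ ^ (-α))))
      = ENNReal.ofReal (Real.pi * Real.Gamma (1 - 2 / α) * s ^ (2 / α)) := by
  have hα0 : 0 < α := by linarith
  have hδ1 : 2 / α < 1 := by rwa [div_lt_one hα0]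
  have hΓ := Real.Gamma_pos_of_pos (sub_pos.2 hδ1)
  have hint : ∀ x : ℝ, ∫ t in (0 : ℝ)..x, s * Real.exp (-(s * t)) = 1 - Real.exp (-(s * x)) :=
    fun x => by
      have hd : ∀ t ∈ Set.uIcc 0 x,
          HasDerivAt (fun t => -Real.exp (-(s * t))) (s * Real.exp (-(s * t))) t := fun t _ => by
        have := (((hasDerivAt_id t).const_mul s).neg.exp).neg
        exact this.congr_deriv (by simp; ring)
      rw [intervalIntegral.integral_eq_sub_of_hasDerivAt hd
        (Continuous.intervalIntegrable (by fun_prop) _ _)]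
      simp; ring
  have h1 := lintegral_comp_eq_lintegral_meas_lt_mul (volume : Measure Plane)
    (f := fun z => ‖z‖ ^ (-α)) (g := fun t => s * Real.exp (-(s * t)))
    (ae_of_all _ fun z => by positivity) (by fun_prop)
    (fun t _ => Continuous.intervalIntegrable (by fun_prop) _ _)
    (ae_of_all _ fun t => by positivity)
  simp only [hint] at h1
  have h2 : ∀ z : Plane, 1 - expNeg (ENNReal.ofReal (s * ‖z‖ ^ (-α)))
      = ENNReal.ofReal (1 - Real.exp (-(s * ‖z‖ ^ (-α)))) := fun z => by
    rw [expNeg_ofReal (by positivity), ENNReal.ofReal_sub _ (by positivity), ENNReal.ofReal_one]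
  simp_rw [h2]
  rw [h1]
  have h3 : ∀ t ∈ Set.Ioi (0 : ℝ), volume {a : Plane | t < ‖a‖ ^ (-α)} *
        ENNReal.ofReal (s * Real.exp (-(s * t)))
      = ENNReal.ofReal (Real.pi * s) *
          ENNReal.ofReal (t ^ ((1 - 2 / α) - 1) * Real.exp (-(s * t))) := fun t ht => by
    have ht0 : (0 : ℝ) < t := ht
    rw [volume_lt_norm_rpow hα0 ht, ← ENNReal.ofReal_mul (by positivity),
      ← ENNReal.ofReal_mul (by positivity)]
    congr 1
    rw [show (1 - 2 / α) - 1 = -(2 / α) by ring]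
    ring
  rw [setLIntegral_congr_fun measurableSet_Ioi h3, lintegral_const_mul _ (by fun_prop),
    lintegral_rpow_mul_exp_neg (sub_pos.2 hδ1) hs, ← ENNReal.ofReal_mul (by positivity)]
  congr 1
  rw [one_div, Real.inv_rpow hs.le, Real.rpow_sub hs, Real.rpow_one]
  field_simp

/-- The sum `∑ ‖z‖ ^ (-α)` over the points: the interference at the origin when all potential
interferers transmit without fading. For a homogeneous Poisson process it is a positive stable
variable of index `2 / α`. -/
noncomputable def shotNoise (α : ℝ) (φ : Set Plane) : ℝ≥0∞ :=
  ∑' z : φ, ENNReal.ofReal (‖(z : Plane)‖ ^ (-α))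

/-- The Gamma integral `∫ s ^ (δ - 1) exp (-s y) ds = Γ(δ) y ^ (-δ)`, valid for all
`y` in `[0, ∞]`. -/
lemma lintegral_rpow_mul_expNeg {δ : ℝ} (hδ : 0 < δ) (y : ℝ≥0∞) :
    ∫⁻ s in Set.Ioi (0 : ℝ), ENNReal.ofReal (s ^ (δ - 1)) * expNeg (ENNReal.ofReal s * y)
      = ENNReal.ofReal (Real.Gamma δ) * y ^ (-δ) := by
  have hΓ := Real.Gamma_pos_of_pos hδ
  rcases eq_or_ne y 0 with rfl | hy0
  · simp only [mul_zero, expNeg_zero, mul_one]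
    rw [ENNReal.zero_rpow_of_neg (by linarith), ENNReal.mul_top (by simpa using hΓ)]
    by_contra hne
    refine not_integrableOn_Ioi_rpow (δ - 1) ?_
    refine (lintegral_ofReal_ne_top_iff_integrable (by fun_prop) ?_).1 hne
    filter_upwards [ae_restrict_mem measurableSet_Ioi] with t ht
    exact Real.rpow_nonneg (le_of_lt ht) _
  rcases eq_or_ne y ∞ with rfl | hyt
  · rw [ENNReal.top_rpow_of_neg (by linarith), mul_zero]
    refine setLIntegral_eq_zero measurableSet_Ioi fun s hs => ?_
    have hs' : 0 < s := hs
    simp [ENNReal.mul_top, hs']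
  lift y to NNReal using hyt
  have hy : 0 < (y : ℝ) := by
    have : y ≠ 0 := by simpa using hy0
    positivity
  have h1 : ∀ s ∈ Set.Ioi (0 : ℝ), ENNReal.ofReal (s ^ (δ - 1)) * expNeg (ENNReal.ofReal s * y)
      = ENNReal.ofReal (s ^ (δ - 1) * Real.exp (-(y * s))) := fun s hs => by
    have hs' : (0 : ℝ) < s := hs
    rw [← ENNReal.ofReal_coe_nnreal, ← ENNReal.ofReal_mul hs'.le, expNeg_ofReal (by positivity),
      ← ENNReal.ofReal_mul (by positivity), mul_comm s]
  rw [setLIntegral_congr_fun measurableSet_Ioi h1, lintegral_rpow_mul_exp_neg hδ hy,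
    ← ENNReal.ofReal_coe_nnreal, ENNReal.ofReal_rpow_of_pos hy, ← ENNReal.ofReal_mul hΓ.le, one_div,
    Real.inv_rpow hy.le, ← Real.rpow_neg hy.le, mul_comm]

section PoissonPoints

variable {Ω : Type*} [MeasurableSpace Ω] {P : Measure Ω} {Φ : Ω → Set Plane}

lemma lintegral_expNeg_tsum_homogeneous [IsFiniteMeasure P] {lam : ℝ}
    (hΦ : IsHomogeneousPoisson P Φ lam) {f : Plane → ℝ≥0∞} (hf : Measurable f) :
    ∫⁻ ω, expNeg (∑' z : Φ ω, f z) ∂P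
      = expNeg (ENNReal.ofReal lam * ∫⁻ z, (1 - expNeg (f z))) := by
  have : IsFiniteMeasureOnCompacts (ENNReal.ofReal lam • (volume : Measure Plane)) :=
    IsFiniteMeasureOnCompacts.smul _ ENNReal.ofReal_ne_top
  rw [lintegral_expNeg_tsum hΦ hf, lintegral_smul_measure, smul_eq_mul]

lemma measurable_shotNoise {lam : ℝ} (hΦ : IsHomogeneousPoisson P Φ lam) (α : ℝ) :
    Measurable fun ω => shotNoise α (Φ ω) :=
  measurable_tsum hΦ (f := fun z => ENNReal.ofReal (‖z‖ ^ (-α))) (by fun_prop)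

lemma lintegral_expNeg_shotNoise [IsFiniteMeasure P] {lam : ℝ} (hlam : 0 < lam)
    (hΦ : IsHomogeneousPoisson P Φ lam) {α s : ℝ} (hα : 2 < α) (hs : 0 < s) :
    ∫⁻ ω, expNeg (ENNReal.ofReal s * shotNoise α (Φ ω)) ∂P
      = ENNReal.ofReal
          (Real.exp (-(lam * Real.pi * Real.Gamma (1 - 2 / α)) * s ^ (2 / α))) := by
  have hδ1 : 2 / α < 1 := by rwa [div_lt_one (by linarith)]
  have hΓ := Real.Gamma_pos_of_pos (sub_pos.2 hδ1)
  have h1 : ∀ ω, ENNReal.ofReal s * shotNoise α (Φ ω)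
      = ∑' z : Φ ω, ENNReal.ofReal (s * ‖(z : Plane)‖ ^ (-α)) := fun ω => by
    rw [shotNoise, ← ENNReal.tsum_mul_left]
    simp_rw [ENNReal.ofReal_mul hs.le]
  simp_rw [h1]
  rw [lintegral_expNeg_tsum_homogeneous hΦ (f := fun z => ENNReal.ofReal (s * ‖z‖ ^ (-α)))
    (by fun_prop), lintegral_one_sub_expNeg_norm_rpow hα hs, ← ENNReal.ofReal_mul hlam.le,
    expNeg_ofReal (by positivity)]
  congr 2; ring

/-- The moment of order `-2 / α` of the shot noise, from its Laplace transform `exp (-b s ^ δ)`, the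
Gamma integral for `y ^ (-δ)`, and Tonelli's theorem. -/
theorem lintegral_shotNoise_rpow_neg [IsProbabilityMeasure P] {lam : ℝ} (hlam : 0 < lam)
    (hΦ : IsHomogeneousPoisson P Φ lam) {α : ℝ} (hα : 2 < α) :
    ∫⁻ ω, shotNoise α (Φ ω) ^ (-(2 / α)) ∂P
      = ENNReal.ofReal
          (1 / (lam * Real.pi * (Real.Gamma (1 + 2 / α) * Real.Gamma (1 - 2 / α)))) := by
  have hδ0 : 0 < 2 / α := by apply div_pos <;> linarith
  have hδ1 : 2 / α < 1 := by rwa [div_lt_one (by linarith)]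
  set δ := 2 / α with hδ
  have hΓ := Real.Gamma_pos_of_pos hδ0
  have hΓ1 := Real.Gamma_pos_of_pos (sub_pos.2 hδ1)
  have hY := measurable_shotNoise hΦ α
  set b := lam * Real.pi * Real.Gamma (1 - δ) with hb
  have hb0 : 0 < b := by positivity
  have hswap : ∫⁻ ω, ENNReal.ofReal (Real.Gamma δ) * shotNoise α (Φ ω) ^ (-δ) ∂P
      = ∫⁻ s in Set.Ioi (0 : ℝ), ENNReal.ofReal (s ^ (δ - 1)) *
          ∫⁻ ω, expNeg (ENNReal.ofReal s * shotNoise α (Φ ω)) ∂P := by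
    simp_rw [← lintegral_rpow_mul_expNeg hδ0]
    rw [lintegral_lintegral_swap]
    · refine lintegral_congr fun s => ?_
      rw [lintegral_const_mul _ (by fun_prop)]
    · refine Measurable.aemeasurable ?_
      exact ((measurable_snd.pow_const _).ennreal_ofReal).mul (measurable_expNeg.comp
        (measurable_snd.ennreal_ofReal.mul (hY.comp measurable_fst)))
  have hint : ∫⁻ s in Set.Ioi (0 : ℝ), ENNReal.ofReal (s ^ (δ - 1)) *
        ∫⁻ ω, expNeg (ENNReal.ofReal s * shotNoise α (Φ ω)) ∂P = ENNReal.ofReal (1 / (b * δ)) := by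
    have h1 : ∀ s ∈ Set.Ioi (0 : ℝ), ENNReal.ofReal (s ^ (δ - 1)) *
        ∫⁻ ω, expNeg (ENNReal.ofReal s * shotNoise α (Φ ω)) ∂P
        = ENNReal.ofReal (s ^ (δ - 1) * Real.exp (-b * s ^ δ)) := fun s hs => by
      rw [lintegral_expNeg_shotNoise hlam hΦ hα hs,
        ← ENNReal.ofReal_mul (Real.rpow_nonneg (le_of_lt hs) _)]
    rw [setLIntegral_congr_fun measurableSet_Ioi h1]
    refine lintegral_ofReal_eq_of_integral_eq ?_ (by positivity) ?_
    · filter_upwards [ae_restrict_mem measurableSet_Ioi] with t ht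
      have : 0 < t := ht
      positivity
    · rw [integral_rpow_mul_exp_neg_mul_rpow hδ0 (by linarith) hb0, sub_add_cancel, neg_div,
        div_self hδ0.ne', Real.Gamma_one, Real.rpow_neg_one]
      field_simp
  rw [lintegral_const_mul _ (by fun_prop), hint] at hswap
  have hΓne : ENNReal.ofReal (Real.Gamma δ) ≠ 0 := by simpa using hΓ
  rw [← ENNReal.mul_right_inj hΓne ENNReal.ofReal_ne_top, hswap, ← ENNReal.ofReal_mul hΓ.le,
    add_comm 1 δ, Real.Gamma_add_one hδ0.ne']
  congr 1
  rw [hb]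
  field_simp

end PoissonPoints

lemma rayleighLaw_Ici {μ ρ : ℝ} (hμ : 0 < μ) (hρ : 0 ≤ ρ) :
    rayleighLaw μ (Set.Ici ρ) = ENNReal.ofReal (Real.exp (-(Real.pi * μ * ρ ^ 2))) := by
  have hset : (Set.Ici ρ ∩ Set.Ioi 0 : Set ℝ) =ᵐ[volume] Set.Ioi ρ := by
    refine (Ioi_ae_eq_Ici.symm.inter (ae_eq_refl _)).trans ?_
    rw [Set.inter_eq_left.2 (Set.Ioi_subset_Ioi hρ)]
    rfl
  rw [rayleighLaw, withDensity_apply _ measurableSet_Ici,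
    Measure.restrict_restrict measurableSet_Ici, setLIntegral_congr hset]
  have hd : ∀ x ∈ Set.Ici ρ, HasDerivAt (fun a => -Real.exp (-(Real.pi * μ * a ^ 2)))
      (2 * Real.pi * μ * x * Real.exp (-(Real.pi * μ * x ^ 2))) x := fun x _ => by
    have := ((((hasDerivAt_pow 2 x).const_mul (Real.pi * μ)).neg).exp).neg
    exact this.congr_deriv (by simp; ring)
  have hlim : Tendsto (fun a : ℝ => -Real.exp (-(Real.pi * μ * a ^ 2))) atTop (𝓝 0) := by
    rw [← neg_zero]
    refine Tendsto.neg (Real.tendsto_exp_neg_atTop_nhds_zero.comp ?_)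
    exact (tendsto_pow_atTop two_ne_zero).const_mul_atTop (mul_pos Real.pi_pos hμ)
  refine lintegral_ofReal_eq_of_integral_eq ?_ (by positivity) ?_
  · filter_upwards [ae_restrict_mem measurableSet_Ioi] with t ht
    have : 0 < t := hρ.trans_lt ht
    positivity
  · rw [integral_Ioi_of_hasDerivAt_of_nonneg' hd (fun x hx => by
      have : 0 < x := hρ.trans_lt hx
      positivity) hlim]
    simp

lemma rayleighLaw_Iic_zero (μ : ℝ) : rayleighLaw μ (Set.Iic 0) = 0 := by
  have h : (volume.restrict (Set.Ioi 0) : Measure ℝ) (Set.Iic 0) = 0 := by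
    rw [Measure.restrict_apply measurableSet_Iic, Set.Iic_inter_Ioi, Set.Ioc_self, measure_empty]
  exact withDensity_absolutelyContinuous _ _ h

lemma rayleighLaw_univ {μ : ℝ} (hμ : 0 < μ) : rayleighLaw μ Set.univ = 1 := by
  have h0 : rayleighLaw μ (Set.Iio 0) = 0 :=
    measure_mono_null Set.Iio_subset_Iic_self (rayleighLaw_Iic_zero μ)
  rw [← Set.Iio_union_Ici (a := (0 : ℝ)), measure_union
    (Set.disjoint_left.2 fun x (h1 : x ∈ Set.Iio 0) (h2 : x ∈ Set.Ici 0) =>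
      absurd (Set.mem_Iio.1 h1) (not_lt.2 (Set.mem_Ici.1 h2))) measurableSet_Ici, h0,
    rayleighLaw_Ici hμ le_rfl]
  simp

instance isProbabilityMeasure_rayleighLaw_one : IsProbabilityMeasure (rayleighLaw 1) :=
  ⟨rayleighLaw_univ one_pos⟩

lemma ae_pos_rayleighLaw_one : ∀ᵐ r ∂rayleighLaw 1, 0 < r := by
  rw [ae_iff]
  exact measure_mono_null (fun r hr => not_lt.1 hr) (rayleighLaw_Iic_zero 1)

/-- Under the Rayleigh law with parameter `1`, `π r ^ 2` is exponential with mean `1`; this gives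
the probability of `r ^ α * y < κ`. The degenerate values `y = 0` and `y = ∞` need no
exception. -/
lemma rayleighLaw_one_rpow_mul_lt {α κ : ℝ} (hα : 0 < α) (hκ : 0 < κ) (y : ℝ≥0∞) :
    rayleighLaw 1 {r | ENNReal.ofReal (r ^ α) * y < ENNReal.ofReal κ}
      = 1 - expNeg (ENNReal.ofReal (Real.pi * κ ^ (2 / α)) * y ^ (-(2 / α))) := by
  have hδ0 : 0 < 2 / α := by positivity
  have hpos : 0 < Real.pi * κ ^ (2 / α) := by positivity
  rcases eq_or_ne y 0 with rfl | hy0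
  · simp [hκ, ENNReal.zero_rpow_of_neg (neg_neg_of_pos hδ0), ENNReal.mul_top, hpos]
  rcases eq_or_ne y ∞ with rfl | hyt
  · rw [ENNReal.top_rpow_of_neg (neg_neg_of_pos hδ0), mul_zero, expNeg_zero, tsub_self]
    refine measure_mono_null (fun r hr => ?_) (rayleighLaw_Iic_zero 1)
    by_contra hcon
    have : 0 < r ^ α := Real.rpow_pos_of_pos (not_le.1 hcon) _
    simp [ENNReal.mul_top, this] at hr
  lift y to NNReal using hyt
  have hy : 0 < (y : ℝ) := by
    have : y ≠ 0 := by simpa using hy0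
    positivity
  have hset : {r : ℝ | ENNReal.ofReal (r ^ α) * y < ENNReal.ofReal κ}
      =ᵐ[rayleighLaw 1] ((Set.Ici ((κ / y) ^ α⁻¹))ᶜ : Set ℝ) := by
    rw [eventuallyEq_set]
    filter_upwards [ae_pos_rayleighLaw_one] with r hr
    rw [Set.mem_compl_iff, Set.mem_Ici, not_le,
      Real.lt_rpow_inv_iff_of_pos hr.le (by positivity) hα,
      lt_div_iff₀ hy, ← ENNReal.ofReal_coe_nnreal, ← ENNReal.ofReal_mul (by positivity),
      ENNReal.ofReal_lt_ofReal_iff hκ]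
  rw [measure_congr hset, prob_compl_eq_one_sub measurableSet_Ici,
    rayleighLaw_Ici one_pos (by positivity), mul_one, ← ENNReal.ofReal_coe_nnreal,
    ENNReal.ofReal_rpow_of_pos hy, ← ENNReal.ofReal_mul hpos.le, expNeg_ofReal (by positivity)]
  congr 4
  rw [← Real.rpow_natCast, ← Real.rpow_mul (by positivity), Real.div_rpow hκ.le hy.le,
    Real.rpow_neg hy.le]
  rw [show α⁻¹ * (2 : ℕ) = 2 / α by push_cast; ring]
  ring

/-! ### Comparison of the total loss with the shot noise -/

/-- Minus the logarithm of the conditional success probability, given the interferers `φ` and the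
link distance `r`. -/
noncomputable def totalLoss (α θ p : ℝ) (φ : Set Plane) (r : ℝ) : ℝ≥0∞ :=
  ∑' z : φ, ENNReal.ofReal (logLoss p (gain α θ r z))

lemma measurable_uncurry_logLoss_gain (α θ p : ℝ) :
    Measurable (Function.uncurry fun (r : ℝ) z => ENNReal.ofReal (logLoss p (gain α θ r z))) :=
  ((measurable_logLoss p).comp (measurable_gain α θ)).ennreal_ofReal

section PoissonPoints

variable {Ω : Type*} [MeasurableSpace Ω] {P : Measure Ω} {Φ : Ω → Set Plane}

lemma IsPoissonProcess.countable {Λ : Measure Plane} (hΦ : IsPoissonProcess P Φ Λ) (ω : Ω) :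
    (Φ ω).Countable := by
  have h : Φ ω = ⋃ n : ℕ, Φ ω ∩ Metric.closedBall 0 n := by
    rw [← Set.inter_iUnion, Metric.iUnion_closedBall_nat, Set.inter_univ]
  rw [h]
  exact Set.countable_iUnion fun n =>
    (hΦ.locallyFinite ω _ (isCompact_closedBall _ _)).countable

/-- A point of intensity zero is almost surely not a point of the process: its count `N` satisfies
`E exp (-∞ * N) = 1`. -/
lemma IsPoissonProcess.ae_notMem [IsProbabilityMeasure P] {Λ : Measure Plane}
    (hΦ : IsPoissonProcess P Φ Λ) {z : Plane} (hz : Λ {z} = 0) : ∀ᵐ ω ∂P, z ∉ Φ ω := by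
  have hm : Measurable fun n : ℕ∞ => expNeg (∞ * n) := measurable_of_countable _
  have h1 := lintegral_expNeg_count hΦ (measurableSet_singleton z) (by simp [hz]) ∞
  rw [hz, zero_mul, expNeg_zero] at h1
  have h2 := ae_eq_of_ae_le_of_lintegral_le (μ := P)
    (f := fun ω => expNeg (∞ * (Φ ω ∩ {z}).encard)) (g := fun _ => 1)
    (ae_of_all _ fun ω => expNeg_le_one _) (by rw [h1]; simp) aemeasurable_const
    (by rw [h1]; simp)
  filter_upwards [h2] with ω hω hmem
  rw [Set.inter_eq_right.2 (Set.singleton_subset_iff.2 hmem)] at hω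
  simp at hω

lemma IsHomogeneousPoisson.ae_zero_notMem [IsProbabilityMeasure P] {lam : ℝ}
    (hΦ : IsHomogeneousPoisson P Φ lam) : ∀ᵐ ω ∂P, 0 ∉ Φ ω :=
  IsPoissonProcess.ae_notMem hΦ (by simp)

lemma measurable_totalLoss {lam : ℝ} (hΦ : IsHomogeneousPoisson P Φ lam) (α θ p : ℝ) :
    Measurable fun q : Ω × ℝ => totalLoss α θ p (Φ q.1) q.2 :=
  measurable_tsum_prod hΦ (measurable_uncurry_logLoss_gain α θ p)

lemma one_sub_lt_toReal_expNeg_iff {ε : ℝ} (hε : ε ∈ Set.Ioo (0 : ℝ) 1) (x : ℝ≥0∞) :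
    1 - ε < (expNeg x).toReal ↔ x < ENNReal.ofReal (-Real.log (1 - ε)) := by
  have h1 : 0 < 1 - ε := by linarith [hε.2]
  have h2 : expNeg (ENNReal.ofReal (-Real.log (1 - ε))) = ENNReal.ofReal (1 - ε) := by
    rw [expNeg_ofReal (neg_nonneg.2 (Real.log_nonpos h1.le (by linarith [hε.1]))), neg_neg,
      Real.exp_log h1]
  rw [← strictAnti_expNeg.lt_iff_gt, h2, ENNReal.ofReal_lt_iff_lt_toReal h1.le (expNeg_ne_top x)]

/-- The link is reliable when the total loss is below `-log (1 - ε)`. The right-hand side is the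
probability of a measurable event, whereas the set in the definition agrees with it only almost
everywhere. -/
lemma metaDistribution_eq [IsProbabilityMeasure P] {lam : ℝ} (hΦ : IsHomogeneousPoisson P Φ lam)
    {α θ ε : ℝ} (hθ : 0 < θ) (p : unitInterval) (hε : ε ∈ Set.Ioo (0 : ℝ) 1) :
    metaDistribution P Φ 1 α θ p ε
      = (P.prod (rayleighLaw 1)).real
          {q | totalLoss α θ p (Φ q.1) q.2 < ENNReal.ofReal (-Real.log (1 - ε))} := by
  rw [metaDistribution]
  refine measureReal_congr ?_
  rw [eventuallyEq_set]
  filter_upwards [Measure.quasiMeasurePreserving_fst.ae hΦ.ae_zero_notMem,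
    Measure.quasiMeasurePreserving_snd.ae ae_pos_rayleighLaw_one] with q h0 hr
  rw [condSuccessProb_eq hθ hr p (IsPoissonProcess.countable hΦ _) h0,
    one_sub_lt_toReal_expNeg_iff hε]
  rfl

/-- The power `-2 / α` of the shot noise, as a real number; it is almost surely finite for a
homogeneous Poisson process. -/
noncomputable def negPowShotNoise (α : ℝ) (φ : Set Plane) : ℝ := (shotNoise α φ ^ (-(2 / α))).toReal

lemma measurable_negPowShotNoise {lam : ℝ} (hΦ : IsHomogeneousPoisson P Φ lam) (α : ℝ) :
    Measurable fun ω => negPowShotNoise α (Φ ω) :=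
  ((measurable_shotNoise hΦ α).pow_const _).ennreal_toReal

lemma integrable_negPowShotNoise [IsProbabilityMeasure P] {lam : ℝ} (hlam : 0 < lam)
    (hΦ : IsHomogeneousPoisson P Φ lam) {α : ℝ} (hα : 2 < α) :
    Integrable (fun ω => negPowShotNoise α (Φ ω)) P := by
  refine integrable_toReal_of_lintegral_ne_top
    ((measurable_shotNoise hΦ α).pow_const _).aemeasurable ?_
  rw [lintegral_shotNoise_rpow_neg hlam hΦ hα]
  exact ENNReal.ofReal_ne_top

lemma ae_shotNoise_rpow_neg_ne_top [IsProbabilityMeasure P] {lam : ℝ} (hlam : 0 < lam)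
    (hΦ : IsHomogeneousPoisson P Φ lam) {α : ℝ} (hα : 2 < α) :
    ∀ᵐ ω ∂P, shotNoise α (Φ ω) ^ (-(2 / α)) < ∞ := by
  refine ae_lt_top ((measurable_shotNoise hΦ α).pow_const _) ?_
  rw [lintegral_shotNoise_rpow_neg hlam hΦ hα]
  exact ENNReal.ofReal_ne_top

lemma integral_negPowShotNoise [IsProbabilityMeasure P] {lam : ℝ} (hlam : 0 < lam)
    (hΦ : IsHomogeneousPoisson P Φ lam) {α : ℝ} (hα : 2 < α) :
    ∫ ω, negPowShotNoise α (Φ ω) ∂P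
      = 1 / (lam * Real.pi * (Real.Gamma (1 + 2 / α) * Real.Gamma (1 - 2 / α))) := by
  have hδ1 : 2 / α < 1 := by rwa [div_lt_one (by linarith)]
  have hδ0 : 0 < 2 / α := by apply div_pos <;> linarith
  have hΓ := Real.Gamma_pos_of_pos (sub_pos.2 hδ1)
  have hΓ1 := Real.Gamma_pos_of_pos (add_pos one_pos hδ0)
  unfold negPowShotNoise
  rw [integral_toReal ((measurable_shotNoise hΦ α).pow_const _).aemeasurable
    (ae_shotNoise_rpow_neg_ne_top hlam hΦ hα), lintegral_shotNoise_rpow_neg hlam hΦ hα,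
    ENNReal.toReal_ofReal (by positivity)]

lemma measureReal_rpow_mul_shotNoise_lt [IsProbabilityMeasure P] {lam : ℝ} (hlam : 0 < lam)
    (hΦ : IsHomogeneousPoisson P Φ lam) {α κ : ℝ} (hα : 2 < α) (hκ : 0 < κ) :
    (P.prod (rayleighLaw 1)).real
        {q | ENNReal.ofReal (q.2 ^ α) * shotNoise α (Φ q.1) < ENNReal.ofReal κ}
      = ∫ ω, (1 - Real.exp (-(Real.pi * κ ^ (2 / α) * negPowShotNoise α (Φ ω)))) ∂P := by
  have hY := measurable_shotNoise hΦ α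
  have hS : MeasurableSet {q : Ω × ℝ |
      ENNReal.ofReal (q.2 ^ α) * shotNoise α (Φ q.1) < ENNReal.ofReal κ} :=
    measurableSet_lt ((measurable_snd.pow_const α).ennreal_ofReal.mul (hY.comp measurable_fst))
      measurable_const
  have hnn : ∀ ω, 0 ≤ Real.pi * κ ^ (2 / α) * negPowShotNoise α (Φ ω) := fun ω =>
    mul_nonneg (by positivity) ENNReal.toReal_nonneg
  have hm := measurable_negPowShotNoise hΦ α
  have hmeas : Measurable fun ω =>
      1 - Real.exp (-(Real.pi * κ ^ (2 / α) * negPowShotNoise α (Φ ω))) :=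
    (hm.const_mul _).neg.exp.const_sub 1
  rw [measureReal_def, Measure.prod_apply hS, integral_eq_lintegral_of_nonneg_ae
    (ae_of_all _ fun ω => by simpa using hnn ω)
    hmeas.aestronglyMeasurable]
  congr 1
  refine lintegral_congr_ae ?_
  filter_upwards [ae_shotNoise_rpow_neg_ne_top hlam hΦ hα] with ω hω
  have h1 := rayleighLaw_one_rpow_mul_lt (α := α) (by linarith) hκ (shotNoise α (Φ ω))
  change rayleighLaw 1 {r | _} = _
  simp only [Set.mem_ofPred_eq]
  rw [h1, ← ENNReal.ofReal_toReal hω.ne, ← ENNReal.ofReal_mul (by positivity),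
    ← negPowShotNoise, expNeg_ofReal (hnn ω), ENNReal.ofReal_sub _ (by positivity),
    ENNReal.ofReal_one]

lemma integral_one_sub_exp_le {V : Ω → ℝ} (hV : Integrable V P) (hV0 : ∀ ω, 0 ≤ V ω)
    {t : ℝ} (ht : 0 ≤ t) : ∫ ω, (1 - Real.exp (-(t * V ω))) ∂P ≤ t * ∫ ω, V ω ∂P := by
  rw [← integral_const_mul]
  refine integral_mono_of_nonneg (ae_of_all _ fun ω => ?_) (hV.const_mul t)
    (ae_of_all _ fun ω => ?_)
  · simpa using mul_nonneg ht (hV0 ω)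
  · have := Real.add_one_le_exp (-(t * V ω))
    simp only; linarith

lemma tendsto_integral_one_sub_exp_div {V : Ω → ℝ} (hV : Integrable V P) (hV0 : ∀ ω, 0 ≤ V ω) :
    Tendsto (fun t : ℝ => (∫ ω, (1 - Real.exp (-(t * V ω))) ∂P) / t) (𝓝[>] 0)
      (𝓝 (∫ ω, V ω ∂P)) := by
  simp_rw [← integral_div]
  refine tendsto_integral_filter_of_dominated_convergence V ?_ ?_ hV (ae_of_all _ fun ω => ?_)
  · have := hV.aestronglyMeasurable
    exact Eventually.of_forall fun t => by fun_prop
  · filter_upwards [self_mem_nhdsWithin] with t ht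
    have ht0 : 0 < t := ht
    refine ae_of_all _ fun ω => ?_
    have h1 := Real.add_one_le_exp (-(t * V ω))
    have h2 : Real.exp (-(t * V ω)) ≤ 1 := by simpa using mul_nonneg ht0.le (hV0 ω)
    rw [Real.norm_eq_abs, abs_of_nonneg (div_nonneg (by linarith) ht0.le), div_le_iff₀ ht0]
    linarith
  · have hd : HasDerivAt (fun t : ℝ => 1 - Real.exp (-(t * V ω))) (V ω) 0 := by
      have := (((hasDerivAt_id (0 : ℝ)).mul_const (V ω)).neg.exp).const_sub 1
      exact this.congr_deriv (by simp)
    have := hd.tendsto_slope_zero_right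
    simpa [div_eq_inv_mul] using this

end PoissonPoints

lemma logLoss_le {p x : ℝ} (hp0 : 0 ≤ p) (hp1 : p ≤ 1) (hx : 0 ≤ x) : logLoss p x ≤ p * x := by
  have hpos := one_sub_mul_div_pos hp1 hx
  rw [logLoss, ← Real.log_inv]
  refine (Real.log_le_sub_one_of_pos (inv_pos.2 hpos)).trans ?_
  have h1 : 0 ≤ (1 - p) * x := mul_nonneg (by linarith) hx
  have h2 : (1 - p * (x / (1 + x)))⁻¹ - 1 = p * x / (1 + (1 - p) * x) := by
    have h3 : 1 - p * (x / (1 + x)) = (1 + (1 - p) * x) / (1 + x) := by field_simp; ring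
    have h4 : 1 + (1 - p) * x ≠ 0 := by positivity
    rw [h3, inv_div, div_sub_one h4]
    congr 1; ring
  rw [h2]
  exact div_le_self (by positivity) (by linarith)

lemma le_logLoss {p x : ℝ} (hp1 : p ≤ 1) (hx : 0 ≤ x) :
    p * (x / (1 + x)) ≤ logLoss p x := by
  have := Real.log_le_sub_one_of_pos (one_sub_mul_div_pos hp1 hx)
  rw [logLoss]; linarith

lemma mul_div_lt_of_logLoss_lt {p x ε : ℝ} (hp1 : p ≤ 1) (hx : 0 ≤ x) (hε : ε < 1)
    (h : logLoss p x < -Real.log (1 - ε)) : p * (x / (1 + x)) < ε := by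
  rw [logLoss, neg_lt_neg_iff,
    Real.log_lt_log_iff (by linarith) (one_sub_mul_div_pos hp1 hx)] at h
  linarith

/-- An interferer whose loss is below `-log (1 - ε)` has a loss at least linear in `x`, with slope
`p - ε`. With `logLoss_le` this pins the total loss of a reliable link between `p - ε` and `p` times
a linear functional of the points. -/
lemma sub_mul_le_logLoss {p x ε : ℝ} (hp1 : p ≤ 1) (hx : 0 ≤ x) (hε : ε < 1)
    (h : logLoss p x < -Real.log (1 - ε)) : (p - ε) * x ≤ logLoss p x := by
  refine le_trans ?_ (le_logLoss hp1 hx)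
  have h1 := mul_div_lt_of_logLoss_lt hp1 hx hε h
  have h2 : p * (x / (1 + x)) = (p - p * (x / (1 + x))) * x := by field_simp; ring
  rw [h2]
  exact mul_le_mul_of_nonneg_right (by linarith) hx

lemma tsum_ofReal_mul_gain {α θ r k : ℝ} (hθ : 0 < θ) (hr : 0 < r) (hk : 0 ≤ k) (φ : Set Plane) :
    ∑' z : φ, ENNReal.ofReal (k * gain α θ r z)
      = ENNReal.ofReal (k * θ) * (ENNReal.ofReal (r ^ α) * shotNoise α φ) := by
  rw [shotNoise, ← ENNReal.tsum_mul_left, ← ENNReal.tsum_mul_left]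
  refine tsum_congr fun z => ?_
  rw [← ENNReal.ofReal_mul (by positivity), ← ENNReal.ofReal_mul (by positivity), gain]
  congr 1; ring

lemma ofReal_mul_lt_ofReal_iff {a c : ℝ} (ha : 0 < a) (x : ℝ≥0∞) :
    ENNReal.ofReal a * x < ENNReal.ofReal c ↔ x < ENNReal.ofReal (c / a) := by
  rw [ENNReal.ofReal_div_of_pos ha, ENNReal.lt_div_iff_mul_lt
    (Or.inl (ENNReal.ofReal_pos.2 ha).ne') (Or.inl ENNReal.ofReal_ne_top), mul_comm]

lemma totalLoss_lt_of_shotNoise_lt {α θ p r c : ℝ} (hθ : 0 < θ) (hr : 0 < r) (hp0 : 0 < p)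
    (hp1 : p ≤ 1) {φ : Set Plane}
    (h : ENNReal.ofReal (r ^ α) * shotNoise α φ < ENNReal.ofReal (c / (p * θ))) :
    totalLoss α θ p φ r < ENNReal.ofReal c := by
  rw [← ofReal_mul_lt_ofReal_iff (by positivity), ← tsum_ofReal_mul_gain hθ hr hp0.le] at h
  refine lt_of_le_of_lt (ENNReal.tsum_le_tsum fun z => ?_) h
  exact ENNReal.ofReal_le_ofReal (logLoss_le hp0.le hp1 (gain_nonneg hθ hr _))

lemma logLoss_lt_of_totalLoss_lt {α θ p r c : ℝ} (hc : 0 < c) {φ : Set Plane}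
    (h : totalLoss α θ p φ r < ENNReal.ofReal c) {z : Plane} (hz : z ∈ φ) :
    logLoss p (gain α θ r z) < c := by
  have h1 : ENNReal.ofReal (logLoss p (gain α θ r z)) ≤ totalLoss α θ p φ r :=
    ENNReal.le_tsum (f := fun z : φ => ENNReal.ofReal (logLoss p (gain α θ r z))) ⟨z, hz⟩
  exact (ENNReal.ofReal_lt_ofReal_iff hc).1 (h1.trans_lt h)

lemma neg_log_one_sub_pos {ε : ℝ} (hε : ε ∈ Set.Ioo (0 : ℝ) 1) : 0 < -Real.log (1 - ε) :=
  neg_pos.2 (Real.log_neg (by linarith [hε.2]) (by linarith [hε.1]))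

lemma shotNoise_lt_of_totalLoss_lt {α θ p r ε : ℝ} (hθ : 0 < θ) (hr : 0 < r)
    (hp1 : p ≤ 1) (hε : ε ∈ Set.Ioo (0 : ℝ) 1) (hεp : ε < p) {φ : Set Plane}
    (h : totalLoss α θ p φ r < ENNReal.ofReal (-Real.log (1 - ε))) :
    ENNReal.ofReal (r ^ α) * shotNoise α φ
      < ENNReal.ofReal (-Real.log (1 - ε) / ((p - ε) * θ)) := by
  have hpε : 0 < p - ε := by linarith
  rw [← ofReal_mul_lt_ofReal_iff (by positivity), ← tsum_ofReal_mul_gain hθ hr hpε.le]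
  refine lt_of_le_of_lt (ENNReal.tsum_le_tsum fun z => ?_) h
  exact ENNReal.ofReal_le_ofReal (sub_mul_le_logLoss hp1 (gain_nonneg hθ hr _) hε.2
    (logLoss_lt_of_totalLoss_lt (neg_log_one_sub_pos hε) h z.2))

/-! ### Asymptotics of the density of reliable links -/

section

variable {Ω : Type*} [MeasurableSpace Ω] {P : Measure Ω} {Φ : Ω → Set Plane}

lemma measureReal_prod_rayleighLaw_mono [IsProbabilityMeasure P] {s t : Set (Ω × ℝ)}
    (h : ∀ q : Ω × ℝ, 0 < q.2 → q ∈ s → q ∈ t) :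
    (P.prod (rayleighLaw 1)).real s ≤ (P.prod (rayleighLaw 1)).real t := by
  refine ENNReal.toReal_mono (measure_ne_top _ _) (measure_mono_ae ?_)
  filter_upwards [Measure.quasiMeasurePreserving_snd.ae ae_pos_rayleighLaw_one] with q hr hq
  exact h q hr hq

lemma reliableDensity_le [IsProbabilityMeasure P] {lam : ℝ} (hlam : 0 < lam)
    (hΦ : IsHomogeneousPoisson P Φ lam) {α θ ε : ℝ} (hα : 2 < α) (hθ : 0 < θ) (p : unitInterval)
    (hε : ε ∈ Set.Ioo (0 : ℝ) 1) (hεp : ε < p) :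
    reliableDensity P Φ 1 α θ lam p ε ≤ lam * p * ∫ ω, (1 - Real.exp (-(Real.pi *
      (-Real.log (1 - ε) / ((p - ε) * θ)) ^ (2 / α) * negPowShotNoise α (Φ ω)))) ∂P := by
  have hc := neg_log_one_sub_pos hε
  have hpε : 0 < (p : ℝ) - ε := by linarith
  rw [reliableDensity, metaDistribution_eq hΦ hθ p hε,
    ← measureReal_rpow_mul_shotNoise_lt hlam hΦ hα (by positivity)]
  refine mul_le_mul_of_nonneg_left (measureReal_prod_rayleighLaw_mono fun q hq h => ?_)
    (mul_nonneg hlam.le p.2.1)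
  exact shotNoise_lt_of_totalLoss_lt hθ hq p.2.2 hε hεp h

lemma le_reliableDensity [IsProbabilityMeasure P] {lam : ℝ} (hlam : 0 < lam)
    (hΦ : IsHomogeneousPoisson P Φ lam) {α θ ε : ℝ} (hα : 2 < α) (hθ : 0 < θ) (p : unitInterval)
    (hp : 0 < p) (hε : ε ∈ Set.Ioo (0 : ℝ) 1) :
    lam * p * ∫ ω, (1 - Real.exp (-(Real.pi *
      (-Real.log (1 - ε) / (p * θ)) ^ (2 / α) * negPowShotNoise α (Φ ω)))) ∂P
      ≤ reliableDensity P Φ 1 α θ lam p ε := by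
  have hc := neg_log_one_sub_pos hε
  have hp' : (0 : ℝ) < p := hp
  rw [reliableDensity, metaDistribution_eq hΦ hθ p hε,
    ← measureReal_rpow_mul_shotNoise_lt hlam hΦ hα (by positivity)]
  refine mul_le_mul_of_nonneg_left (measureReal_prod_rayleighLaw_mono fun q hq h => ?_)
    (mul_nonneg hlam.le p.2.1)
  exact totalLoss_lt_of_shotNoise_lt hθ hq hp' p.2.2 h

lemma negPowShotNoise_nonneg (α : ℝ) (φ : Set Plane) : 0 ≤ negPowShotNoise α φ :=
  ENNReal.toReal_nonneg

/-- Upper bound for the density of reliable links that is uniform in the density of the process. -/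
lemma reliableDensity_le_rpow [IsProbabilityMeasure P] {lam : ℝ} (hlam : 0 < lam)
    (hΦ : IsHomogeneousPoisson P Φ lam) {α θ ε : ℝ} (hα : 2 < α) (hθ : 0 < θ) (p : unitInterval)
    (hε : ε ∈ Set.Ioo (0 : ℝ) 1) (hεp : ε < p) :
    reliableDensity P Φ 1 α θ lam p ε ≤ p * (-Real.log (1 - ε) / ((p - ε) * θ)) ^ (2 / α) /
      (Real.Gamma (1 + 2 / α) * Real.Gamma (1 - 2 / α)) := by
  have hδ1 : 2 / α < 1 := by rwa [div_lt_one (by linarith)]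
  have hδ0 : 0 < 2 / α := by apply div_pos <;> linarith
  have hΓ := Real.Gamma_pos_of_pos (sub_pos.2 hδ1)
  have hΓ1 := Real.Gamma_pos_of_pos (add_pos one_pos hδ0)
  have hc := neg_log_one_sub_pos hε
  have hpε : 0 < (p : ℝ) - ε := by linarith
  refine (reliableDensity_le hlam hΦ hα hθ p hε hεp).trans ?_
  refine (mul_le_mul_of_nonneg_left (integral_one_sub_exp_le (integrable_negPowShotNoise hlam hΦ hα)
    (fun ω => negPowShotNoise_nonneg α _) (by positivity)) (mul_nonneg hlam.le p.2.1)).trans_eq ?_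
  rw [integral_negPowShotNoise hlam hΦ hα]
  field_simp

lemma tendsto_neg_log_one_sub_div :
    Tendsto (fun ε : ℝ => -Real.log (1 - ε) / ε) (𝓝[>] 0) (𝓝 1) := by
  have hd : HasDerivAt (fun ε : ℝ => -Real.log (1 - ε)) 1 0 :=
    (((hasDerivAt_id (0 : ℝ)).const_sub 1).log (by simp)).neg.congr_deriv (by simp)
  have := hd.tendsto_slope_zero_right
  simpa [div_eq_inv_mul] using this

lemma eventually_mem_Ioo : ∀ᶠ ε : ℝ in 𝓝[>] 0, ε ∈ Set.Ioo (0 : ℝ) 1 :=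
  Ioo_mem_nhdsGT one_pos

/-- Small-`ε` behaviour of the probability of `R ^ α * ∑ ‖z‖ ^ (-α) < -log (1 - ε) / k`, as `k`
converges. Both sides of the sandwich have this form, with `k = p * θ` and `k = (p - ε) * θ`. -/
lemma tendsto_mul_integral_div_rpow [IsProbabilityMeasure P] {lam : ℝ} (hlam : 0 < lam)
    (hΦ : IsHomogeneousPoisson P Φ lam) {α k₀ : ℝ} (hα : 2 < α) (p : ℝ) {k : ℝ → ℝ} (hk₀ : 0 < k₀)
    (hk : Tendsto k (𝓝[>] 0) (𝓝 k₀)) :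
    Tendsto (fun ε => lam * p * (∫ ω, (1 - Real.exp (-(Real.pi *
        (-Real.log (1 - ε) / k ε) ^ (2 / α) * negPowShotNoise α (Φ ω)))) ∂P) / ε ^ (2 / α)) (𝓝[>] 0)
      (𝓝 (p / (k₀ ^ (2 / α) * (Real.Gamma (1 + 2 / α) * Real.Gamma (1 - 2 / α))))) := by
  have hδ1 : 2 / α < 1 := by rwa [div_lt_one (by linarith)]
  have hδ0 : 0 < 2 / α := by apply div_pos <;> linarith
  have hΓ := Real.Gamma_pos_of_pos (sub_pos.2 hδ1)
  have hΓ1 := Real.Gamma_pos_of_pos (add_pos one_pos hδ0)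
  set δ := 2 / α with hδ
  have hkpos : ∀ᶠ ε in 𝓝[>] (0 : ℝ), 0 < k ε := hk.eventually (lt_mem_nhds hk₀)
  set t : ℝ → ℝ := fun ε => Real.pi * (-Real.log (1 - ε) / k ε) ^ δ with ht
  have hratio : Tendsto (fun ε => t ε / ε ^ δ) (𝓝[>] 0) (𝓝 (Real.pi * (1 / k₀) ^ δ)) := by
    have h1 : Tendsto (fun ε : ℝ => Real.pi * ((-Real.log (1 - ε) / ε) / k ε) ^ δ) (𝓝[>] 0)
        (𝓝 (Real.pi * (1 / k₀) ^ δ)) :=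
      ((tendsto_neg_log_one_sub_div.div hk hk₀.ne').rpow_const (Or.inr hδ0.le)).const_mul _
    refine h1.congr' ?_
    filter_upwards [eventually_mem_Ioo, hkpos] with ε hε hkε
    have hc := neg_log_one_sub_pos hε
    rw [ht, div_right_comm, Real.div_rpow (by positivity) hε.1.le, mul_div_assoc]
  have hεδ : Tendsto (fun ε : ℝ => ε ^ δ) (𝓝[>] 0) (𝓝 0) := by
    have : ContinuousAt (fun ε : ℝ => ε ^ δ) 0 :=
      Real.continuousAt_rpow_const _ _ (Or.inr hδ0.le)
    have h2 := this.tendsto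
    simp only [Real.zero_rpow hδ0.ne'] at h2
    exact h2.mono_left nhdsWithin_le_nhds
  have htlim : Tendsto t (𝓝[>] 0) (𝓝[>] 0) := by
    refine tendsto_nhdsWithin_iff.2 ⟨?_, ?_⟩
    · have := hratio.mul hεδ
      rw [mul_zero] at this
      refine this.congr' ?_
      filter_upwards [eventually_mem_Ioo] with ε hε
      exact div_mul_cancel₀ _ (Real.rpow_pos_of_pos hε.1 _).ne'
    · filter_upwards [eventually_mem_Ioo, hkpos] with ε hε hkε
      have hc := neg_log_one_sub_pos hε
      exact Set.mem_Ioi.2 (by positivity)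
  have hU := (tendsto_integral_one_sub_exp_div (integrable_negPowShotNoise hlam hΦ hα)
    (fun ω => negPowShotNoise_nonneg α _)).comp htlim
  have hmain := ((hU.mul hratio).const_mul (lam * p))
  have hval : lam * p * ((∫ ω, negPowShotNoise α (Φ ω) ∂P) * (Real.pi * (1 / k₀) ^ δ))
      = p / (k₀ ^ δ * (Real.Gamma (1 + δ) * Real.Gamma (1 - δ))) := by
    rw [integral_negPowShotNoise hlam hΦ hα, ← hδ, Real.div_rpow one_pos.le hk₀.le, Real.one_rpow]
    field_simp
  rw [hval] at hmain
  refine hmain.congr' ?_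
  filter_upwards [eventually_mem_Ioo, htlim.eventually self_mem_nhdsWithin] with ε hε htε
  have htε' : t ε ≠ 0 := (Set.mem_Ioi.1 htε).ne'
  have := (Real.rpow_pos_of_pos hε.1 δ).ne'
  simp only [Function.comp_apply]
  change _ = lam * p * (∫ ω, (1 - Real.exp (-(t ε * negPowShotNoise α (Φ ω)))) ∂P) / ε ^ δ
  field_simp

/-- The limit of the density of reliable links divided by `ε ^ (2 / α)`. The limit does not depend
on the density of the process: the factor `lam` cancels against the negative moment of the shot
noise. -/
theorem tendsto_reliableDensity_div_rpow [IsProbabilityMeasure P] {lam : ℝ} (hlam : 0 < lam)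
    (hΦ : IsHomogeneousPoisson P Φ lam) {α θ : ℝ} (hα : 2 < α) (hθ : 0 < θ) (p : unitInterval)
    (hp : 0 < p) :
    Tendsto (fun ε => reliableDensity P Φ 1 α θ lam p ε / ε ^ (2 / α)) (𝓝[>] 0)
      (𝓝 (p / ((p * θ) ^ (2 / α) * (Real.Gamma (1 + 2 / α) * Real.Gamma (1 - 2 / α))))) := by
  have hp' : (0 : ℝ) < p := hp
  have hk : Tendsto (fun ε : ℝ => ((p : ℝ) - ε) * θ) (𝓝[>] 0) (𝓝 (p * θ)) := by
    have : Continuous fun ε : ℝ => ((p : ℝ) - ε) * θ := by fun_prop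
    simpa using (this.tendsto 0).mono_left nhdsWithin_le_nhds
  refine tendsto_of_tendsto_of_tendsto_of_le_of_le'
    (tendsto_mul_integral_div_rpow hlam hΦ hα p (by positivity) tendsto_const_nhds)
    (tendsto_mul_integral_div_rpow hlam hΦ hα p (by positivity) hk) ?_ ?_
  · filter_upwards [eventually_mem_Ioo] with ε hε
    exact div_le_div_of_nonneg_right (le_reliableDensity hlam hΦ hα hθ p hp hε)
      (Real.rpow_nonneg hε.1.le _)
  · filter_upwards [eventually_mem_Ioo, Ioo_mem_nhdsGT hp'] with ε hε hεp
    exact div_le_div_of_nonneg_right (reliableDensity_le hlam hΦ hα hθ p hε hεp.2)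
      (Real.rpow_nonneg hε.1.le _)

end

/-! ### A bound linear in the access probability -/

/-- The Laplace transform of the exponential variable `π R ^ 2`. The integrand is, up to the factor
`1 / (1 + b)`, the Rayleigh density with parameter `1 + b`. -/
lemma lintegral_expNeg_rayleighLaw_one {b : ℝ} (hb : 0 ≤ b) :
    ∫⁻ r, expNeg (ENNReal.ofReal (b * (Real.pi * r ^ 2))) ∂rayleighLaw 1
      = ENNReal.ofReal (1 / (1 + b)) := by
  have h1 : ∀ r : ℝ, ENNReal.ofReal (2 * Real.pi * 1 * r * Real.exp (-(Real.pi * 1 * r ^ 2))) *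
        expNeg (ENNReal.ofReal (b * (Real.pi * r ^ 2)))
      = ENNReal.ofReal (1 / (1 + b)) * ENNReal.ofReal (2 * Real.pi * (1 + b) * r *
          Real.exp (-(Real.pi * (1 + b) * r ^ 2))) := fun r => by
    rw [expNeg_ofReal (by positivity), ← ENNReal.ofReal_mul' (by positivity),
      ← ENNReal.ofReal_mul (by positivity), mul_assoc _ (Real.exp _), ← Real.exp_add,
      show -(Real.pi * 1 * r ^ 2) + -(b * (Real.pi * r ^ 2)) = -(Real.pi * (1 + b) * r ^ 2) by ring]
    congr 1
    field_simp
  rw [rayleighLaw, lintegral_withDensity_eq_lintegral_mul _ (by fun_prop) (by fun_prop)]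
  simp only [Pi.mul_apply, h1]
  rw [lintegral_const_mul _ (by fun_prop), ← setLIntegral_univ,
    ← withDensity_apply _ MeasurableSet.univ]
  change _ * rayleighLaw (1 + b) Set.univ = _
  rw [rayleighLaw_univ (by linarith), mul_one]

lemma volume_closedBall_sdiff_zero {r : ℝ} (hr : 0 ≤ r) :
    volume (Metric.closedBall (0 : Plane) r \ {0}) = ENNReal.ofReal (Real.pi * r ^ 2) := by
  rw [measure_sdiff_null (measure_singleton 0), EuclideanSpace.volume_closedBall_fin_two,
    ← ENNReal.ofReal_pow hr, ← ENNReal.ofReal_mul (by positivity), mul_comm]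

lemma half_le_one_sub_exp_neg {a : ℝ} (ha0 : 0 ≤ a) (ha1 : a ≤ 1) :
    a / 2 ≤ 1 - Real.exp (-a) := by
  have h1 : Real.exp (-a) ≤ 1 / (1 + a) := by
    rw [Real.exp_neg, ← one_div]
    exact one_div_le_one_div_of_le (by linarith) (by linarith [Real.add_one_le_exp a])
  have h2 : a / 2 ≤ 1 - 1 / (1 + a) := by
    rw [one_sub_div (by linarith), add_sub_cancel_left]
    exact div_le_div_of_nonneg_left ha0 (by linarith) (by linarith)
  linarith

lemma mul_le_logLoss_gain {α θ p r : ℝ} (hα : 0 < α) (hθ : 0 < θ) (hp0 : 0 ≤ p) (hp1 : p ≤ 1)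
    {z : Plane} (hz : z ≠ 0) (hzr : ‖z‖ ≤ r) :
    p * (θ / (1 + θ)) ≤ logLoss p (gain α θ r z) := by
  have hz0 : 0 < ‖z‖ := norm_pos_iff.2 hz
  have hr : 0 < r := hz0.trans_le hzr
  refine le_trans ?_ (le_logLoss hp1 (gain_nonneg hθ hr z))
  refine mul_le_mul_of_nonneg_left ?_ hp0
  have h1 : θ ≤ gain α θ r z := by
    rw [gain, mul_assoc, Real.rpow_neg hz0.le, ← div_eq_mul_inv]
    have := Real.rpow_le_rpow hz0.le hzr hα.le
    have hpos := Real.rpow_pos_of_pos hz0 α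
    exact le_mul_of_one_le_right hθ.le ((one_le_div hpos).2 this)
  rw [div_le_div_iff₀ (by linarith) (by linarith)]
  nlinarith

section

variable {Ω : Type*} [MeasurableSpace Ω] {P : Measure Ω} {Φ : Ω → Set Plane}

/-- A bound on the density of reliable links for all densities and access probabilities. Each
interferer closer than the desired transmitter costs at least `p * θ / (1 + θ)`, so a reliable
link has at most about `-log (1 - ε) / p` of them; an exponential Markov bound for their Poisson
number gives the estimate. It is finite for every `ε`, and for `p` of order `ε` it is of order
`ε`, which is negligible against `ε ^ (2 / α)`. -/
theorem reliableDensity_le_linear [IsProbabilityMeasure P] {lam : ℝ} (hlam : 0 < lam)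
    (hΦ : IsHomogeneousPoisson P Φ lam) {α θ ε : ℝ} (hα : 2 < α) (hθ : 0 < θ) (p : unitInterval)
    (hp : 0 < p) (hε : ε ∈ Set.Ioo (0 : ℝ) 1) :
    reliableDensity P Φ 1 α θ lam p ε
      ≤ 2 * Real.exp 1 * (-Real.log (1 - ε) * ((1 + θ) / θ) + p) := by
  have hc := neg_log_one_sub_pos hε
  have hp' : (0 : ℝ) < p := hp
  set c := -Real.log (1 - ε) with hcdef
  set v := θ / (1 + θ) with hv
  have hv0 : 0 < v := by positivity
  -- the weight `a ≤ 1` per point is chosen so that a reliable link has total weight at most `1`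
  set a := p * v / (c + p * v) with ha
  have ha0 : 0 < a := by positivity
  have ha1 : a ≤ 1 := by rw [ha, div_le_one (by positivity)]; linarith
  set q := 1 - Real.exp (-a) with hq
  have hqa : a / 2 ≤ q := half_le_one_sub_exp_neg ha0.le ha1
  have hq0 : 0 < q := by linarith
  classical
  let f : ℝ → Plane → ℝ≥0∞ := fun r =>
    (Metric.closedBall (0 : Plane) r \ {0}).indicator fun _ => ENNReal.ofReal a
  have hset : ∀ r, MeasurableSet (Metric.closedBall (0 : Plane) r \ {0}) := fun r =>
    Metric.isClosed_closedBall.measurableSet.diff (measurableSet_singleton 0)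
  have hf : Measurable (Function.uncurry f) := by
    have h1 : MeasurableSet ({x : ℝ × Plane | ‖x.2‖ ≤ x.1} ∩ Prod.snd ⁻¹' {0}ᶜ) :=
      (measurableSet_le (by fun_prop) (by fun_prop)).inter
        (measurable_snd (measurableSet_singleton (0 : Plane)).compl)
    have h2 : Function.uncurry f = ({x : ℝ × Plane | ‖x.2‖ ≤ x.1} ∩ Prod.snd ⁻¹' {0}ᶜ).indicator
        fun _ => ENNReal.ofReal a := by
      ext x
      simp [Function.uncurry, f, Set.indicator_apply]
    rw [h2]
    exact measurable_const.indicator h1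
  have hF : Measurable fun x : Ω × ℝ => expNeg (∑' z : Φ x.1, f x.2 z) :=
    measurable_expNeg.comp (measurable_tsum_prod hΦ hf)
  have hE : MeasurableSet {x : Ω × ℝ | totalLoss α θ p (Φ x.1) x.2 < ENNReal.ofReal c} :=
    measurableSet_lt (measurable_totalLoss hΦ α θ p) measurable_const
  have hpt : ∀ x : Ω × ℝ,
      {x : Ω × ℝ | totalLoss α θ p (Φ x.1) x.2 < ENNReal.ofReal c}.indicator 1 x
        ≤ ENNReal.ofReal (Real.exp 1) * expNeg (∑' z : Φ x.1, f x.2 z) := fun x => by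
    by_cases hx : x ∈ {x : Ω × ℝ | totalLoss α θ p (Φ x.1) x.2 < ENNReal.ofReal c}
    swap
    · rw [Set.indicator_of_notMem hx]; exact zero_le
    rw [Set.indicator_of_mem hx]
    have hterm : ∀ z : Plane, f x.2 z
        ≤ ENNReal.ofReal (1 / (c + p * v)) * ENNReal.ofReal (logLoss p (gain α θ x.2 z)) := by
      intro z
      by_cases hz : z ∈ Metric.closedBall (0 : Plane) x.2 \ {0}
      swap
      · simp only [f, Set.indicator_of_notMem hz]; exact zero_le
      simp only [f, Set.indicator_of_mem hz]
      rw [← ENNReal.ofReal_mul (by positivity)]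
      refine ENNReal.ofReal_le_ofReal ?_
      rw [ha, div_mul_eq_mul_div, one_mul]
      refine div_le_div_of_nonneg_right ?_ (by positivity)
      exact mul_le_logLoss_gain (by linarith) hθ p.2.1 p.2.2 (by simpa using hz.2)
        (by simpa using hz.1)
    have hsum : ∑' z : Φ x.1, f x.2 z ≤ ENNReal.ofReal 1 := by
      refine (ENNReal.tsum_le_tsum fun z : Φ x.1 => hterm z).trans ?_
      rw [ENNReal.tsum_mul_left]
      refine (mul_le_mul_right (le_of_lt hx) _).trans ?_
      rw [← ENNReal.ofReal_mul (by positivity)]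
      refine ENNReal.ofReal_le_ofReal ?_
      rw [div_mul_eq_mul_div, one_mul, div_le_one (by positivity)]
      linarith [mul_pos hp' hv0]
    have h1 := strictAnti_expNeg.antitone hsum
    rw [expNeg_ofReal zero_le_one] at h1
    refine le_trans ?_ (mul_le_mul_right h1 _)
    rw [← ENNReal.ofReal_mul (by positivity), ← Real.exp_add]
    simp
  have hlap : ∀ r : ℝ, 0 < r → ∫⁻ ω, expNeg (∑' z : Φ ω, f r z) ∂P
      = expNeg (ENNReal.ofReal (lam * q * (Real.pi * r ^ 2))) := fun r hr => by
    have h1 : ∀ z, 1 - expNeg (f r z) = (Metric.closedBall (0 : Plane) r \ {0}).indicator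
        (fun _ => ENNReal.ofReal q) z := fun z => by
      by_cases hz : z ∈ Metric.closedBall (0 : Plane) r \ {0}
      · simp only [f, Set.indicator_of_mem hz]
        rw [expNeg_ofReal ha0.le, hq, ENNReal.ofReal_sub _ (by positivity), ENNReal.ofReal_one]
      · simp only [f, Set.indicator_of_notMem hz, expNeg_zero, tsub_self]
    rw [lintegral_expNeg_tsum_homogeneous hΦ (f := f r) (measurable_const.indicator (hset r))]
    simp_rw [h1]
    rw [lintegral_indicator_const (hset r), volume_closedBall_sdiff_zero hr.le,
      ← ENNReal.ofReal_mul hq0.le, ← ENNReal.ofReal_mul hlam.le, mul_assoc]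
  have hmeas : (P.prod (rayleighLaw 1)) {x | totalLoss α θ p (Φ x.1) x.2 < ENNReal.ofReal c}
      ≤ ENNReal.ofReal (Real.exp 1 * (1 / (1 + lam * q))) := by
    rw [← lintegral_indicator_one hE]
    refine (lintegral_mono hpt).trans ?_
    rw [lintegral_const_mul _ hF, lintegral_prod_symm' _ hF,
      ENNReal.ofReal_mul (Real.exp_pos 1).le,
      ← lintegral_expNeg_rayleighLaw_one (by positivity)]
    refine mul_le_mul_right (le_of_eq (lintegral_congr_ae ?_)) _
    filter_upwards [ae_pos_rayleighLaw_one] with r hr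
    exact hlap r hr
  have hreal : (P.prod (rayleighLaw 1)).real {x | totalLoss α θ p (Φ x.1) x.2 < ENNReal.ofReal c}
      ≤ Real.exp 1 * (1 / (1 + lam * q)) :=
    ENNReal.toReal_le_of_le_ofReal (by positivity) hmeas
  rw [reliableDensity, metaDistribution_eq hΦ hθ p hε]
  refine (mul_le_mul_of_nonneg_left hreal (by positivity)).trans ?_
  have h1 : lam * p * (Real.exp 1 * (1 / (1 + lam * q))) ≤ p * Real.exp 1 / q := by
    rw [mul_one_div, mul_div_assoc', div_le_div_iff₀ (by positivity) hq0]
    nlinarith [mul_pos hp' (Real.exp_pos 1)]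
  refine h1.trans ?_
  have h2 : p * Real.exp 1 / q ≤ p * Real.exp 1 / (a / 2) :=
    div_le_div_of_nonneg_left (by positivity) (by positivity) hqa
  refine h2.trans_eq ?_
  rw [ha, hv]
  field_simp

end

/-! ### Thinning the process instead of the transmissions -/

/-- A law on `[0, 1]` is determined by its moments, by the Weierstrass approximation theorem. -/
lemma ext_of_integral_pow_eq {μ ν : Measure ℝ} [IsProbabilityMeasure μ] [IsProbabilityMeasure ν]
    (hμ : ∀ᵐ x ∂μ, x ∈ Set.Icc (0 : ℝ) 1) (hν : ∀ᵐ x ∂ν, x ∈ Set.Icc (0 : ℝ) 1)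
    (h : ∀ n : ℕ, ∫ x, x ^ n ∂μ = ∫ x, x ^ n ∂ν) : μ = ν := by
  have hint : ∀ (ρ : Measure ℝ) [IsProbabilityMeasure ρ], (∀ᵐ x ∂ρ, x ∈ Set.Icc (0 : ℝ) 1) →
      ∀ g : ℝ → ℝ, Continuous g → Integrable g ρ := fun ρ _ hρ g hg => by
    obtain ⟨C, hC⟩ := isCompact_Icc.exists_bound_of_continuousOn (s := Set.Icc (0 : ℝ) 1)
      hg.continuousOn
    refine Integrable.of_bound hg.aestronglyMeasurable C ?_
    filter_upwards [hρ] with x hx using hC x hx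
  have hpoly : ∀ q : Polynomial ℝ, ∫ x, q.eval x ∂μ = ∫ x, q.eval x ∂ν := fun q => by
    have key : ∀ (ρ : Measure ℝ) [IsProbabilityMeasure ρ], (∀ᵐ x ∂ρ, x ∈ Set.Icc (0 : ℝ) 1) →
        ∫ x, q.eval x ∂ρ = ∑ i ∈ Finset.range (q.natDegree + 1), q.coeff i * ∫ x, x ^ i ∂ρ :=
      fun ρ _ hρ => by
        simp_rw [Polynomial.eval_eq_sum_range]
        rw [integral_finsetSum _ fun i _ => hint ρ hρ _ (by fun_prop)]
        simp_rw [integral_const_mul]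
    rw [key μ hμ, key ν hν]
    simp_rw [h]
  refine ext_of_forall_integral_eq_of_IsFiniteMeasure fun f => ?_
  refine eq_of_forall_dist_le fun e he => ?_
  obtain ⟨q, hq⟩ := exists_polynomial_near_of_continuousOn 0 1 f f.continuous.continuousOn (e / 2)
    (by positivity)
  have key : ∀ (ρ : Measure ℝ) [IsProbabilityMeasure ρ], (∀ᵐ x ∂ρ, x ∈ Set.Icc (0 : ℝ) 1) →
      |∫ x, f x ∂ρ - ∫ x, q.eval x ∂ρ| ≤ e / 2 := fun ρ _ hρ => by
    rw [← integral_sub (hint ρ hρ _ f.continuous) (hint ρ hρ _ q.continuous)]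
    have := norm_integral_le_of_norm_le_const (μ := ρ) (f := fun x => f x - q.eval x) (C := e / 2)
      (by filter_upwards [hρ] with x hx
          rw [Real.norm_eq_abs, abs_sub_comm]
          exact (hq x hx).le)
    simpa using this
  have h1 := key μ hμ
  have h2 := key ν hν
  rw [hpoly q] at h1
  rw [Real.dist_eq]
  rw [abs_le] at h1 h2 ⊢
  constructor <;> linarith [h1.1, h1.2, h2.1, h2.2]

lemma integral_pow_map_expNeg {Ω : Type*} [MeasurableSpace Ω] (P : Measure Ω)
    {X : Ω → ℝ≥0∞} (hX : Measurable X) (n : ℕ) :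
    ∫ x, x ^ n ∂P.map (fun ω => (expNeg (X ω)).toReal)
      = (∫⁻ ω, expNeg (n * X ω) ∂P).toReal := by
  have hU : Measurable fun ω => (expNeg (X ω)).toReal :=
    (measurable_expNeg.comp hX).ennreal_toReal
  rw [integral_map hU.aemeasurable (by fun_prop), ← integral_toReal]
  · refine integral_congr_ae (ae_of_all _ fun ω => ?_)
    simp only
    rw [← ENNReal.toReal_pow, mul_comm, expNeg_mul_natCast]
  · exact (measurable_expNeg.comp (hX.const_mul _)).aemeasurable
  · exact ae_of_all _ fun ω => (expNeg_ne_top _).lt_top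

/-- The Laplace transform at the natural numbers determines the law of a variable in `[0, ∞]`, since
these values are the moments of `exp (-X)`. -/
lemma measure_lt_eq_of_lintegral_expNeg_eq {Ω Ω' : Type*} [MeasurableSpace Ω] [MeasurableSpace Ω']
    {P : Measure Ω} {P' : Measure Ω'} [IsProbabilityMeasure P] [IsProbabilityMeasure P']
    {X : Ω → ℝ≥0∞} {X' : Ω' → ℝ≥0∞} (hX : Measurable X) (hX' : Measurable X')
    (h : ∀ n : ℕ, ∫⁻ ω, expNeg (n * X ω) ∂P = ∫⁻ ω, expNeg (n * X' ω) ∂P') (c : ℝ≥0∞) :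
    P {ω | X ω < c} = P' {ω | X' ω < c} := by
  have hU : Measurable fun ω => (expNeg (X ω)).toReal :=
    (measurable_expNeg.comp hX).ennreal_toReal
  have hU' : Measurable fun ω => (expNeg (X' ω)).toReal :=
    (measurable_expNeg.comp hX').ennreal_toReal
  have h01 : ∀ x, (expNeg x).toReal ∈ Set.Icc (0 : ℝ) 1 := fun x =>
    ⟨ENNReal.toReal_nonneg, ENNReal.toReal_le_of_le_ofReal zero_le_one
      (by simpa using expNeg_le_one x)⟩
  have := Measure.isProbabilityMeasure_map (μ := P) hU.aemeasurable
  have := Measure.isProbabilityMeasure_map (μ := P') hU'.aemeasurable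
  have heq : P.map (fun ω => (expNeg (X ω)).toReal)
      = P'.map (fun ω => (expNeg (X' ω)).toReal) := by
    refine ext_of_integral_pow_eq
      ((ae_map_iff hU.aemeasurable measurableSet_Icc).2 (ae_of_all _ fun ω => h01 _))
      ((ae_map_iff hU'.aemeasurable measurableSet_Icc).2 (ae_of_all _ fun ω => h01 _))
      fun n => ?_
    rw [integral_pow_map_expNeg P hX, integral_pow_map_expNeg P' hX', h]
  have hset : ∀ x, x < c ↔ (expNeg c).toReal < (expNeg x).toReal := fun x => by
    rw [ENNReal.toReal_lt_toReal (expNeg_ne_top _) (expNeg_ne_top _), strictAnti_expNeg.lt_iff_gt]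
  have h1 : P.map (fun ω => (expNeg (X ω)).toReal) (Set.Ioi (expNeg c).toReal)
      = P'.map (fun ω => (expNeg (X' ω)).toReal) (Set.Ioi (expNeg c).toReal) := by rw [heq]
  rw [Measure.map_apply hU measurableSet_Ioi, Measure.map_apply hU' measurableSet_Ioi] at h1
  simp_rw [hset]
  exact h1

lemma lintegral_comp_smul_plane {f : Plane → ℝ≥0∞} (hf : Measurable f) {R : ℝ} (hR : 0 < R) :
    ∫⁻ z, f (R • z) = ENNReal.ofReal (R ^ 2)⁻¹ * ∫⁻ z, f z := by
  have h := Measure.map_addHaar_smul (volume : Measure Plane) hR.ne'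
  rw [finrank_euclideanSpace_fin, abs_of_pos (by positivity)] at h
  rw [← lintegral_map hf (measurable_const_smul R), h, lintegral_smul_measure, smul_eq_mul]

/-- Scaling a homogeneous Poisson process gives a homogeneous Poisson process. The processes live on
unrelated probability spaces, and what is compared is the law of a sum over the points. -/
lemma measure_tsum_lt_scaling {Ω Ω' : Type*} [MeasurableSpace Ω] [MeasurableSpace Ω']
    {P : Measure Ω} {P' : Measure Ω'} [IsProbabilityMeasure P] [IsProbabilityMeasure P']
    {Φ : Ω → Set Plane} {Φ' : Ω' → Set Plane} {lam R : ℝ} (hlam : 0 < lam) (hR : 0 < R)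
    (hΦ : IsHomogeneousPoisson P Φ lam) (hΦ' : IsHomogeneousPoisson P' Φ' (lam * R ^ 2))
    {f : Plane → ℝ≥0∞} (hf : Measurable f) (c : ℝ≥0∞) :
    P {ω | ∑' z : Φ ω, f z < c} = P' {ω | ∑' z : Φ' ω, f (R • (z : Plane)) < c} := by
  have hf' : Measurable fun z => f (R • z) := hf.comp (measurable_const_smul R)
  refine measure_lt_eq_of_lintegral_expNeg_eq (measurable_tsum hΦ hf) (measurable_tsum hΦ' hf')
    (fun n => ?_) c
  simp_rw [← ENNReal.tsum_mul_left]
  have hn : Measurable fun z => 1 - expNeg (n * f z) :=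
    measurable_const.sub (measurable_expNeg.comp (hf.const_mul _))
  rw [lintegral_expNeg_tsum_homogeneous hΦ (f := fun z => n * f z) (hf.const_mul _),
    lintegral_expNeg_tsum_homogeneous hΦ' (f := fun z => n * f (R • z)) (hf'.const_mul _),
    lintegral_comp_smul_plane hn hR, ← mul_assoc, ← ENNReal.ofReal_mul (by positivity),
    mul_assoc lam, mul_inv_cancel₀ (by positivity), mul_one]

/-- One interferer with access probability `p` and relative power `p ^ (-β) * x` costs at least as
much as one that always transmits with relative power `x`, as soon as the former cost is
admissible for a reliable link. With `x = p ^ β * y` the inequality of the factors reads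
`p ^ β * y * (1 - p) ≤ p - p ^ β`, while admissibility forces `y * (p - ε) < ε`. -/
lemma logLoss_one_le_logLoss {p β ε x : ℝ} (hp0 : 0 < p) (hp1 : p ≤ 1) (hε : ε < 1)
    (hεp : ε < p) (hK : p ^ β * ε * (1 - p) ≤ (p - ε) * (p - p ^ β)) (hx : 0 ≤ x)
    (h : logLoss p (p ^ (-β) * x) < -Real.log (1 - ε)) :
    logLoss 1 x ≤ logLoss p (p ^ (-β) * x) := by
  have hpβ : 0 < p ^ β := Real.rpow_pos_of_pos hp0 β
  obtain ⟨y, hy, hxy⟩ : ∃ y, 0 ≤ y ∧ x = p ^ β * y :=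
    ⟨p ^ (-β) * x, by positivity, by rw [← mul_assoc, ← Real.rpow_add hp0]; simp⟩
  have hyx : p ^ (-β) * x = y := by
    rw [hxy, ← mul_assoc, ← Real.rpow_add hp0]; simp
  rw [hyx] at h ⊢
  have h1 := mul_div_lt_of_logLoss_lt hp1 hy hε h
  rw [mul_div_assoc', div_lt_iff₀ (by linarith)] at h1
  have h2 : y * (p - ε) ≤ ε := by linarith
  have h3 : p ^ β * y * (1 - p) ≤ p - p ^ β := by
    have hpε : 0 < p - ε := by linarith
    have h4 : (p - ε) * (p ^ β * y * (1 - p)) ≤ (p - ε) * (p - p ^ β) := by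
      refine le_trans ?_ hK
      have := mul_le_mul_of_nonneg_left h2 (mul_nonneg hpβ.le (sub_nonneg.2 hp1))
      linarith
    exact le_of_mul_le_mul_left h4 hpε
  have h5 : x / (1 + x) ≤ p * (y / (1 + y)) := by
    rw [mul_div_assoc', div_le_div_iff₀ (by linarith) (by linarith), hxy]
    have := mul_le_mul_of_nonneg_right h3 hy
    nlinarith
  rw [logLoss, logLoss, neg_le_neg_iff]
  exact Real.log_le_log (one_sub_mul_div_pos hp1 hy) (by linarith)

/-- The hypothesis of `logLoss_one_le_logLoss` on the parameters holds uniformly in `p ≥ 2 * ε`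
once `ε` is small. -/
lemma eventually_forall_rpow_condition {β : ℝ} (hβ : 1 < β) :
    ∀ᶠ ε : ℝ in 𝓝[>] 0, ∀ p : ℝ, 2 * ε ≤ p → p ≤ 1 →
      p ^ β * ε * (1 - p) ≤ (p - ε) * (p - p ^ β) := by
  set m := min 1 (β - 1) with hm
  have hm0 : 0 < m := lt_min one_pos (by linarith)
  have hm1 : m ≤ 1 := min_le_left _ _
  have hlim : Tendsto (fun ε : ℝ => (2 * ε) ^ m) (𝓝[>] 0) (𝓝 0) := by
    have h1 : ContinuousAt (fun ε : ℝ => (2 * ε) ^ m) 0 :=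
      ContinuousAt.rpow_const (by fun_prop) (Or.inr hm0.le)
    have h2 := h1.tendsto
    simp only [mul_zero, Real.zero_rpow hm0.ne'] at h2
    exact h2.mono_left nhdsWithin_le_nhds
  filter_upwards [hlim.eventually (gt_mem_nhds hm0), self_mem_nhdsWithin] with ε hε hε0 p hp hp1
  have hε0' : 0 < ε := hε0
  have hp0 : 0 < p := by linarith
  set s := p ^ (β - 1) with hs
  have hs0 : 0 < s := Real.rpow_pos_of_pos hp0 _
  have hsβ : p ^ β = p * s := by
    rw [hs, ← Real.rpow_one_add' hp0.le (by linarith)]; congr 1; ring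
  have hsm : s ≤ p ^ m := Real.rpow_le_rpow_of_exponent_ge hp0 hp1 (min_le_right _ _)
  -- `m = min 1 (β - 1)` makes the exponent admissible for Bernoulli's inequality and bounds `s`
  have hbern : p ^ m ≤ 1 + m * (p - 1) := by
    have := rpow_one_add_le_one_add_mul_self (s := p - 1) (by linarith) hm0.le hm1
    simpa using this
  have h1 : m * (1 - p) ≤ 1 - s := by linarith
  have h2 : s * (2 * ε) ≤ p * m := by
    have h3 : p ^ m * (2 * ε) ≤ p * (2 * ε) ^ m := by
      have e1 : p ^ m = p * p ^ (m - 1) := by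
        rw [← Real.rpow_one_add' hp0.le (by simpa using hm0.ne')]; congr 1; ring
      have e2 : (2 * ε) ^ m = (2 * ε) ^ (m - 1) * (2 * ε) := by
        rw [← Real.rpow_add_one (by positivity)]; congr 1; ring
      rw [e1, e2, mul_assoc]
      have := Real.rpow_le_rpow_of_nonpos (z := m - 1) (by positivity : 0 < 2 * ε) hp (by linarith)
      gcongr
    calc s * (2 * ε) ≤ p ^ m * (2 * ε) := by gcongr
      _ ≤ p * (2 * ε) ^ m := h3
      _ ≤ p * m := by gcongr
  rw [hsβ]
  have h4 : s * ε ≤ (p - ε) * m := by nlinarith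
  have h5 : s * ε * (1 - p) ≤ (p - ε) * (1 - s) :=
    calc s * ε * (1 - p) ≤ (p - ε) * m * (1 - p) :=
          mul_le_mul_of_nonneg_right h4 (by linarith)
      _ = (p - ε) * (m * (1 - p)) := by ring
      _ ≤ (p - ε) * (1 - s) := mul_le_mul_of_nonneg_left h1 (by linarith)
  nlinarith

lemma gain_smul {R : ℝ} (hR : 0 < R) (α θ r : ℝ) (z : Plane) :
    gain α θ r (R • z) = R ^ (-α) * gain α θ r z := by
  rw [gain, gain, norm_smul, Real.norm_of_nonneg hR.le, Real.mul_rpow hR.le (norm_nonneg _)]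
  ring

/-- Thinning the process to density `lam * p` with permanent activity is at least as good as density
`lam` with access probability `p`. The scaling by `√p` turns one process into the other and
multiplies relative powers by `p ^ (-α / 2)`, so the losses compare pointwise. -/
theorem reliableDensity_le_of_rpow_condition {Ω Ω' : Type*} [MeasurableSpace Ω] [MeasurableSpace Ω']
    {P : Measure Ω} {P' : Measure Ω'} [IsProbabilityMeasure P] [IsProbabilityMeasure P']
    {Φ : Ω → Set Plane} {Φ' : Ω' → Set Plane} {lam : ℝ} (hlam : 0 < lam) (p : unitInterval)
    (hp : 0 < p)
    (hΦ : IsHomogeneousPoisson P Φ lam) (hΦ' : IsHomogeneousPoisson P' Φ' (lam * p))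
    {α θ ε : ℝ} (hθ : 0 < θ) (hε : ε ∈ Set.Ioo (0 : ℝ) 1) (hεp : ε < p)
    (hK : (p : ℝ) ^ (α / 2) * ε * (1 - p) ≤ (p - ε) * (p - (p : ℝ) ^ (α / 2))) :
    reliableDensity P Φ 1 α θ lam p ε ≤ reliableDensity P' Φ' 1 α θ (lam * p) 1 ε := by
  have hp0 : (0 : ℝ) < p := hp
  have hc := neg_log_one_sub_pos hε
  have hR : 0 < √(p : ℝ) := Real.sqrt_pos.2 hp0
  have hR2 : √(p : ℝ) ^ 2 = p := Real.sq_sqrt hp0.le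
  have hRα : √(p : ℝ) ^ (-α) = (p : ℝ) ^ (-(α / 2)) := by
    rw [Real.sqrt_eq_rpow, ← Real.rpow_mul hp0.le]; congr 1; ring
  rw [reliableDensity, reliableDensity, metaDistribution_eq hΦ hθ p hε,
    metaDistribution_eq hΦ' hθ 1 hε, Set.Icc.coe_one, mul_one]
  refine mul_le_mul_of_nonneg_left ?_ (by positivity)
  refine ENNReal.toReal_mono (measure_ne_top _ _) ?_
  rw [Measure.prod_apply_symm (measurableSet_lt (measurable_totalLoss hΦ α θ p) measurable_const),
    Measure.prod_apply_symm (measurableSet_lt (measurable_totalLoss hΦ' α θ 1) measurable_const)]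
  refine lintegral_mono_ae ?_
  filter_upwards [ae_pos_rayleighLaw_one] with r hr
  have hm : Measurable fun z : Plane => ENNReal.ofReal (logLoss p (gain α θ r z)) :=
    ((measurable_logLoss p).comp (by unfold gain; fun_prop)).ennreal_ofReal
  have hΦ'' : IsHomogeneousPoisson P' Φ' (lam * √(p : ℝ) ^ 2) := by rwa [hR2]
  have hscale := measure_tsum_lt_scaling hlam hR hΦ hΦ'' hm (ENNReal.ofReal (-Real.log (1 - ε)))
  refine (le_of_eq hscale).trans (measure_mono fun ω hω => ?_)
  have hω' : ∑' z : Φ' ω, ENNReal.ofReal (logLoss p ((p : ℝ) ^ (-(α / 2)) * gain α θ r z))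
      < ENNReal.ofReal (-Real.log (1 - ε)) := by
    simpa only [Set.mem_ofPred_eq, gain_smul hR, hRα] using hω
  refine lt_of_le_of_lt (ENNReal.tsum_le_tsum fun z => ?_) hω'
  have h1 := ENNReal.le_tsum
    (f := fun z : Φ' ω => ENNReal.ofReal (logLoss p ((p : ℝ) ^ (-(α / 2)) * gain α θ r z))) z
  exact ENNReal.ofReal_le_ofReal (logLoss_one_le_logLoss hp0 p.2.2 hε.2 hεp hK
    (gain_nonneg hθ hr _) ((ENNReal.ofReal_lt_ofReal_iff hc).1 (h1.trans_lt hω')))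

/-! ### The spatial outage capacity -/

lemma isEquivalent_const_mul_of_tendsto_div {ι : Type*} {l : Filter ι} {f g : ι → ℝ} {L : ℝ}
    (hL : L ≠ 0) (hg : ∀ᶠ x in l, g x ≠ 0) (h : Tendsto (fun x => f x / g x) l (𝓝 L)) :
    f ~[l] fun x => L * g x := by
  refine (isEquivalent_iff_tendsto_one ?_).2 ?_
  · filter_upwards [hg] with x hx using mul_ne_zero hL hx
  · have := h.div_const L
    rw [div_self hL] at this
    refine this.congr fun x => ?_
    simp only [Pi.div_apply]
    rw [div_div, mul_comm]

lemma eventually_rpow_ne_zero (δ : ℝ) : ∀ᶠ ε : ℝ in 𝓝[>] 0, ε ^ δ ≠ 0 := by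
  filter_upwards [self_mem_nhdsWithin] with ε hε using (Real.rpow_pos_of_pos hε δ).ne'

/-- The bound of `reliableDensity_le_linear`, with `p ≤ 2 * ε`, is negligible against `ε ^ δ`. -/
lemma tendsto_linear_bound_div_rpow {δ : ℝ} (hδ1 : δ < 1) (C K : ℝ) :
    Tendsto (fun ε : ℝ => C * (-Real.log (1 - ε) * K + 2 * ε) / ε ^ δ) (𝓝[>] 0) (𝓝 0) := by
  have h1 : Tendsto (fun ε : ℝ => ε ^ (1 - δ)) (𝓝[>] 0) (𝓝 0) := by
    have h := (Real.continuousAt_rpow_const 0 (1 - δ) (Or.inr (sub_pos.2 hδ1).le)).tendsto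
    simp only [Real.zero_rpow (sub_pos.2 hδ1).ne'] at h
    exact h.mono_left nhdsWithin_le_nhds
  have h2 := (((tendsto_neg_log_one_sub_div.mul_const K).add_const 2).const_mul C).mul h1
  rw [mul_zero] at h2
  refine h2.congr' ?_
  filter_upwards [self_mem_nhdsWithin] with ε hε
  have hε0 : 0 < ε := hε
  have := (Real.rpow_pos_of_pos hε0 δ).ne'
  rw [Real.rpow_sub hε0, Real.rpow_one]
  field_simp

lemma tendsto_rpow_div_rpow {δ θ : ℝ} (hδ0 : 0 < δ) (hθ : 0 < θ) :
    Tendsto (fun ε : ℝ => (-Real.log (1 - ε) / ((1 - ε) * θ)) ^ δ / ε ^ δ) (𝓝[>] 0)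
      (𝓝 (1 / θ ^ δ)) := by
  have hk : Tendsto (fun ε : ℝ => (1 - ε) * θ) (𝓝[>] 0) (𝓝 θ) := by
    have : Continuous fun ε : ℝ => (1 - ε) * θ := by fun_prop
    simpa using (this.tendsto 0).mono_left nhdsWithin_le_nhds
  have h1 := (tendsto_neg_log_one_sub_div.div hk hθ.ne').rpow_const (p := δ) (Or.inr hδ0.le)
  rw [Real.div_rpow zero_le_one hθ.le, Real.one_rpow] at h1
  refine h1.congr' ?_
  filter_upwards [eventually_mem_Ioo] with ε hε
  have hc := neg_log_one_sub_pos hε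
  have : 0 < 1 - ε := by linarith [hε.2]
  simp only [Pi.div_apply]
  rw [div_right_comm, Real.div_rpow (by positivity) hε.1.le]

section Capacity

variable {Ω : ℝ → Type*} [∀ lam, MeasurableSpace (Ω lam)]
    {P : ∀ lam, Measure (Ω lam)} [∀ lam, IsProbabilityMeasure (P lam)]
    {Φ : ∀ lam, Ω lam → Set Plane}

lemma bddAbove_reliableDensities
    (hΦ : ∀ lam : ℝ, 0 < lam → IsHomogeneousPoisson (P lam) (Φ lam) lam)
    {α θ ε : ℝ} (hα : 2 < α) (hθ : 0 < θ) (hε : ε ∈ Set.Ioo (0 : ℝ) 1) :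
    BddAbove (reliableDensities P Φ 1 α θ ε) := by
  refine ⟨2 * Real.exp 1 * (-Real.log (1 - ε) * ((1 + θ) / θ) + 1), ?_⟩
  rintro x ⟨lam, hlam, p, hp, rfl⟩
  refine (reliableDensity_le_linear hlam (hΦ lam hlam) hα hθ p hp hε).trans ?_
  have := p.2.2
  gcongr

/-- For small `ε` the capacity is already the supremum over `p = 1`. For `p ≥ 2 * ε` a competitor
with `p = 1` is found by thinning; for `p < 2 * ε` the linear bound is below the value at density
`1` and `p = 1`, which is of order `ε ^ (2 / α)`. -/
theorem eventually_isLUB_spatialOutageCapacity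
    (hΦ : ∀ lam : ℝ, 0 < lam → IsHomogeneousPoisson (P lam) (Φ lam) lam)
    {α θ : ℝ} (hα : 2 < α) (hθ : 0 < θ) :
    ∀ᶠ ε : ℝ in 𝓝[>] 0,
      IsLUB {x : ℝ | ∃ lam : ℝ, 0 < lam ∧
          x = reliableDensity (P lam) (Φ lam) 1 α θ lam 1 ε}
        (spatialOutageCapacity P Φ 1 α θ ε) := by
  have hδ1 : 2 / α < 1 := by rwa [div_lt_one (by linarith)]
  have hδ0 : 0 < 2 / α := by apply div_pos <;> linarith
  have hΓ := Real.Gamma_pos_of_pos (sub_pos.2 hδ1)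
  have hΓ1 := Real.Gamma_pos_of_pos (add_pos one_pos hδ0)
  -- the linear bound with `p ≤ 2 * ε` drops below the value at density `1` and `p = 1`
  have hcmp := (tendsto_linear_bound_div_rpow hδ1 (2 * Real.exp 1) ((1 + θ) / θ)).eventually_lt
    (tendsto_reliableDensity_div_rpow one_pos (hΦ 1 one_pos) hα hθ 1 one_pos)
    (by rw [Set.Icc.coe_one, one_mul]; positivity)
  filter_upwards [eventually_mem_Ioo, hcmp,
    eventually_forall_rpow_condition (β := α / 2) (by linarith)] with ε hε hlt hK
  have hbdd := bddAbove_reliableDensities hΦ hα hθ hε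
  refine ⟨?_, fun b hb => ?_⟩
  · rintro x ⟨lam, hlam, rfl⟩
    exact le_csSup hbdd ⟨lam, hlam, 1, one_pos, rfl⟩
  · refine csSup_le ⟨_, 1, one_pos, 1, one_pos, rfl⟩ ?_
    rintro x ⟨lam, hlam, p, hp, rfl⟩
    have hp0 : (0 : ℝ) < p := hp
    rcases le_or_gt (2 * ε) p with h2 | h2
    · have hlamp : 0 < lam * p := by positivity
      exact (reliableDensity_le_of_rpow_condition hlam p hp (hΦ lam hlam) (hΦ _ hlamp) hθ hε
        (by linarith [hε.1]) (hK p h2 p.2.2)).trans (hb ⟨lam * p, hlamp, rfl⟩)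
    · refine (reliableDensity_le_linear hlam (hΦ lam hlam) hα hθ p hp hε).trans ?_
      refine le_trans ?_ (hb ⟨1, one_pos, rfl⟩)
      rw [div_lt_div_iff_of_pos_right (Real.rpow_pos_of_pos hε.1 _)] at hlt
      refine le_trans ?_ hlt.le
      gcongr

theorem tendsto_spatialOutageCapacity_div_rpow
    (hΦ : ∀ lam : ℝ, 0 < lam → IsHomogeneousPoisson (P lam) (Φ lam) lam)
    {α θ : ℝ} (hα : 2 < α) (hθ : 0 < θ) :
    Tendsto (fun ε => spatialOutageCapacity P Φ 1 α θ ε / ε ^ (2 / α)) (𝓝[>] 0)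
      (𝓝 (1 / (θ ^ (2 / α) * (Real.Gamma (1 + 2 / α) * Real.Gamma (1 - 2 / α))))) := by
  have hδ0 : 0 < 2 / α := by apply div_pos <;> linarith
  have hlow := tendsto_reliableDensity_div_rpow one_pos (hΦ 1 one_pos) hα hθ 1 one_pos
  have hup := (tendsto_rpow_div_rpow hδ0 hθ).div_const
    (Real.Gamma (1 + 2 / α) * Real.Gamma (1 - 2 / α))
  rw [div_div] at hup
  rw [Set.Icc.coe_one, one_mul] at hlow
  refine tendsto_of_tendsto_of_tendsto_of_le_of_le' hlow hup ?_ ?_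
  · filter_upwards [eventually_mem_Ioo, eventually_isLUB_spatialOutageCapacity hΦ hα hθ]
      with ε hε hlub
    exact div_le_div_of_nonneg_right (hlub.1 ⟨1, one_pos, rfl⟩) (Real.rpow_nonneg hε.1.le _)
  · filter_upwards [eventually_mem_Ioo, eventually_isLUB_spatialOutageCapacity hΦ hα hθ]
      with ε hε hlub
    rw [div_right_comm]
    refine div_le_div_of_nonneg_right (hlub.2 ?_) (Real.rpow_nonneg hε.1.le _)
    rintro x ⟨lam, hlam, rfl⟩
    have := reliableDensity_le_rpow hlam (hΦ lam hlam) hα hθ 1 hε hε.2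
    rwa [Set.Icc.coe_one, one_mul] at this

end Capacity

end BipolarNetwork

theorem mainTheorem3
    {Ω : ℝ → Type*} [∀ lam, MeasurableSpace (Ω lam)]
    (P : ∀ lam, Measure (Ω lam)) [∀ lam, IsProbabilityMeasure (P lam)]
    (Φ : ∀ lam, Ω lam → Set BipolarNetwork.Plane)
    (hΦ : ∀ lam : ℝ, 0 < lam → BipolarNetwork.IsHomogeneousPoisson (P lam) (Φ lam) lam)
    (α θ δ : ℝ) (hα : 2 < α) (hθ : 0 < θ) (hδ : δ = 2 / α) :
    -- density of reliable links for fixed `λ > 0` and `p ∈ (0, 1]`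
    (∀ (lam : ℝ) (p : unitInterval), 0 < lam → 0 < p →
      (fun ε : ℝ => BipolarNetwork.reliableDensity (P lam) (Φ lam) 1 α θ lam p ε)
        ~[𝓝[>] 0]
      (fun ε : ℝ => ε ^ δ * (p : ℝ) ^ (1 - δ) /
        (θ ^ δ * Real.Gamma (1 + δ) * Real.Gamma (1 - δ)))) ∧
    -- the spatial outage capacity is finite, and its asymptotics
    (∀ ε ∈ Set.Ioo (0 : ℝ) 1, BddAbove (BipolarNetwork.reliableDensities P Φ 1 α θ ε)) ∧
    ((fun ε : ℝ => BipolarNetwork.spatialOutageCapacity P Φ 1 α θ ε)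
        ~[𝓝[>] 0]
      (fun ε : ℝ => (ε / θ) ^ δ / (Real.Gamma (1 + δ) * Real.Gamma (1 - δ)))) ∧
    -- it is achieved at `p = 1`: exactly, as a supremum over `λ`, once `ε` is small, and
    -- asymptotically for each fixed `λ`
    (∀ᶠ ε : ℝ in 𝓝[>] 0,
      IsLUB {x : ℝ | ∃ lam : ℝ, 0 < lam ∧
          x = BipolarNetwork.reliableDensity (P lam) (Φ lam) 1 α θ lam 1 ε}
        (BipolarNetwork.spatialOutageCapacity P Φ 1 α θ ε)) ∧
    (∀ lam : ℝ, 0 < lam →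
      (fun ε : ℝ => BipolarNetwork.reliableDensity (P lam) (Φ lam) 1 α θ lam 1 ε)
        ~[𝓝[>] 0]
      (fun ε : ℝ => BipolarNetwork.spatialOutageCapacity P Φ 1 α θ ε)) := by

  subst hδ
  have hδ1 : 2 / α < 1 := by rwa [div_lt_one (by linarith)]
  have hδ0 : 0 < 2 / α := by apply div_pos <;> linarith
  have hΓ := Real.Gamma_pos_of_pos (sub_pos.2 hδ1)
  have hΓ1 := Real.Gamma_pos_of_pos (add_pos one_pos hδ0)
  have hdens : ∀ (lam : ℝ) (p : unitInterval), 0 < lam → 0 < p →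
      (fun ε : ℝ => BipolarNetwork.reliableDensity (P lam) (Φ lam) 1 α θ lam p ε)
        ~[𝓝[>] 0]
      (fun ε : ℝ => ε ^ (2 / α) * (p : ℝ) ^ (1 - 2 / α) /
        (θ ^ (2 / α) * Real.Gamma (1 + 2 / α) * Real.Gamma (1 - 2 / α))) := by
    intro lam p hlam hp
    have hp0 : (0 : ℝ) < p := hp
    refine (BipolarNetwork.isEquivalent_const_mul_of_tendsto_div (by positivity)
      (BipolarNetwork.eventually_rpow_ne_zero (2 / α))
      (BipolarNetwork.tendsto_reliableDensity_div_rpow hlam (hΦ lam hlam) hα hθ p hp)).congr_right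
      (Eventually.of_forall fun ε => ?_)
    have := (Real.rpow_pos_of_pos hp0 (2 / α)).ne'
    simp only
    rw [Real.mul_rpow hp0.le hθ.le, Real.rpow_sub hp0, Real.rpow_one]
    field_simp
  have hcap : (fun ε : ℝ => BipolarNetwork.spatialOutageCapacity P Φ 1 α θ ε)
        ~[𝓝[>] 0]
      (fun ε : ℝ => (ε / θ) ^ (2 / α) / (Real.Gamma (1 + 2 / α) * Real.Gamma (1 - 2 / α))) := by
    refine (BipolarNetwork.isEquivalent_const_mul_of_tendsto_div (by positivity)
      (BipolarNetwork.eventually_rpow_ne_zero (2 / α))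
      (BipolarNetwork.tendsto_spatialOutageCapacity_div_rpow hΦ hα hθ)).congr_right ?_
    filter_upwards [self_mem_nhdsWithin] with ε hε
    rw [Real.div_rpow (le_of_lt hε) hθ.le]
    field_simp
  refine ⟨hdens, fun ε hε => BipolarNetwork.bddAbove_reliableDensities hΦ hα hθ hε, hcap,
    BipolarNetwork.eventually_isLUB_spatialOutageCapacity hΦ hα hθ, fun lam hlam => ?_⟩
  refine (hdens lam 1 hlam one_pos).trans (hcap.symm.congr_left ?_)
  filter_upwards [self_mem_nhdsWithin] with ε hε
  rw [Real.div_rpow (le_of_lt hε) hθ.le, Set.Icc.coe_one, Real.one_rpow]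
  field_simp
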